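/- Let $\tau\in\mathbb H$, $z\in\mathbb C$, $q=e^{2\pi i\tau}$, $\zeta=e^{2\pi i z}$, and let $$\vartheta(\tau,z)=q^{1/8}\zeta^{1/2}\sum_{n\in\mathbb Z}(-1)^nq^{n(n+1)/2}\zeta^n .$$ Let $\varphi_{0,3/2}(\tau,z)=\vartheta(\tau,2z)/\vartheta(\tau,z)$, $\varphi_{0,3}=\varphi_{0,3/2}^2$ and $\varphi_{0,4}(\tau,z)=\vartheta(\tau,3z)/\vartheta(\tau,z)$, where the quotients are extended to the zeros $z\in\mathbb Z\tau+\mathbb Z$ of the denominator by removing the singularities; $\varphi_{0,3}$ and $\varphi_{0,4}$ have weight $0$ and index $m=3$ and $m=4$ respectively. Let $E_k$ be the Eisenstein series of weight $k$ for $SL_2(\mathbb Z)$ with constant term $1$ ($E_2=1-24\sum_{n\ge1}\sigma_1(n)q^n$ being quasi-modular). For a function $\varphi$ of index $m$ and an integer $k$ put $$H(\varphi)=\frac{12}{2\pi i}\frac{\partial\varphi}{\partial\tau}-\frac3m\frac1{(2\pi i)^2}\frac{\partial^2\varphi}{\partial z^2},\qquad H_k(\varphi)=H(\varphi)-\frac{2k-1}2E_2\,\varphi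 .$$ A function $\varphi$ of weight $0$ and index $m$ is said to satisfy a modular differential equation of order $r$ if there are an integer $w$ and holomorphic modular forms $f_0,\dots,f_r$ for $SL_2(\mathbb Z)$, $f_j$ of weight $w-2j$, with $f_r\ne0$, such that $$f_r\,H_{2r-2}\cdots H_2H_0(\varphi)+\dots+f_1H_0(\varphi)+f_0\,\varphi=0$$ on $\mathbb H\times\mathbb C$. Theorem. 1. On $\mathbb H\times\mathbb C$, with $m=3$, $$H_6H_4H_2H_0(\varphi_{0,3})-\tfrac{29}2E_4H_2H_0(\varphi_{0,3})+22E_6H_0(\varphi_{0,3})-\tfrac{119}{16}E_8\varphi_{0,3}=0 .$$ 2. $\varphi_{0,3}$ satisfies no modular differential equation of order $3$; in particular none with leading coefficient $f_3=1$. 3. On $\mathbb H\times\mathbb C$, with $m=4$, $$H_4H_2H_0(\varphi_{0,4})-\tfrac{107}{16}E_4H_0(\varphi_{0,4})+\tfrac{23}{32}E_6\varphi_{0,4}=0 .$$ -/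

import Mathlib

open scoped MatrixGroups

noncomputable section

namespace JacobiMDE

open UpperHalfPlane Filter Topology

/-- The odd Jacobi theta series
`ϑ(τ, z) = q^(1/8) ζ^(1/2) ∑_{n ∈ ℤ} (-1)^n q^(n(n+1)/2) ζ^n`, where `q = exp (2πiτ)`,
`ζ = exp (2πiz)` and `q^(1/8) = exp (2πiτ/8)`, `ζ^(1/2) = exp (πiz)`. -/
def theta (τ : ℍ) (z : ℂ) : ℂ :=
  Complex.exp (2 * Real.pi * Complex.I * ((τ : ℂ) / 8)) *
    Complex.exp (2 * Real.pi * Complex.I * (z / 2)) *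
    ∑' n : ℤ, (-1 : ℂ) ^ n *
      Complex.exp (2 * Real.pi * Complex.I * ((n : ℂ) * ((n : ℂ) + 1) / 2 * (τ : ℂ))) *
      Complex.exp (2 * Real.pi * Complex.I * ((n : ℂ) * z))

/-- The quotient `ϑ(τ, Nz) / ϑ(τ, z)` as a function on all of `ℍ × ℂ`. The denominator has simple
zeros exactly at the `z ∈ ℤτ + ℤ`, where the numerator vanishes too; the value there is the limit,
and everywhere else the limit is the quotient itself. -/
def thetaQuotient (N : ℕ) (τ : ℍ) (z : ℂ) : ℂ :=
  limUnder (𝓝[≠] z) (fun w : ℂ => theta τ ((N : ℂ) * w) / theta τ w)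

/-- `φ_{0,3/2}(τ, z) = ϑ(τ, 2z) / ϑ(τ, z)`, of weight `0` and index `3/2`. -/
def phiZeroThreeHalves (τ : ℍ) (z : ℂ) : ℂ := thetaQuotient 2 τ z

/-- `φ_{0,3} = φ_{0,3/2}²`, of weight `0` and index `3`. -/
def phiZeroThree (τ : ℍ) (z : ℂ) : ℂ := phiZeroThreeHalves τ z ^ 2

/-- `φ_{0,4}(τ, z) = ϑ(τ, 3z) / ϑ(τ, z)`, of weight `0` and index `4`. -/
def phiZeroFour (τ : ℍ) (z : ℂ) : ℂ := thetaQuotient 3 τ z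

/-- The normalized Eisenstein series `E_2 = 1 - 24 ∑ σ_1(n) q^n`. -/
def E2 (τ : ℍ) : ℂ := EisensteinSeries.E2 τ

/-- The normalized Eisenstein series `E_4 = 1 + 240 ∑ σ_3(n) q^n`. -/
def E4 (τ : ℍ) : ℂ := ModularForm.E (k := 4) (by norm_num) τ

/-- The normalized Eisenstein series `E_6 = 1 - 504 ∑ σ_5(n) q^n`. -/
def E6 (τ : ℍ) : ℂ := ModularForm.E (k := 6) (by norm_num) τ

/-- The normalized Eisenstein series `E_8 = 1 + 480 ∑ σ_7(n) q^n`. -/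
def E8 (τ : ℍ) : ℂ := ModularForm.E (k := 8) (by norm_num) τ

/-- The heat operator of index `m`:
`H^(m) = 12 (1/(2πi)) ∂/∂τ - (3/m) (1/(2πi))² ∂²/∂z²`. -/
def heat (m : ℚ) (φ : ℍ → ℂ → ℂ) (τ : ℍ) (z : ℂ) : ℂ :=
  12 * Derivative.normalizedDerivOfComplex (fun τ' : ℍ => φ τ' z) τ -
    3 / (m : ℂ) * ((2 * Real.pi * Complex.I)⁻¹ ^ 2 * iteratedDeriv 2 (φ τ) z)

/-- The modular correction `H_k(φ) = H^(m)(φ) - ((2k - 1)/2) E_2 φ` of the heat operator on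
functions of weight `k` and index `m`. -/
def modHeat (m : ℚ) (k : ℤ) (φ : ℍ → ℂ → ℂ) (τ : ℍ) (z : ℂ) : ℂ :=
  heat m φ τ z - (2 * (k : ℂ) - 1) / 2 * E2 τ * φ τ z

/-- The iterate `H_{k+2r-2} ⋯ H_{k+2} H_k (φ)` with `r` factors. -/
def modHeatIter (m : ℚ) (k : ℤ) (φ : ℍ → ℂ → ℂ) : ℕ → ℍ → ℂ → ℂ
  | 0 => φ
  | r + 1 => modHeat m (k + 2 * (r : ℤ)) (modHeatIter m k φ r)

/-- `φ`, of weight `k` and index `m`, satisfies a modular differential equation of order `r`: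
`f_r H_{k+2r-2} ⋯ H_k(φ) + ⋯ + f_1 H_k(φ) + f_0 φ = 0`, homogeneous in the weight, with
holomorphic modular forms `f_j` for `SL(2, ℤ)` as coefficients and `f_r ≠ 0`. The case `w = 2r`,
`f_r = 1` is that of an equation with dominant term `H_{k+2r-2} ⋯ H_k(φ)`. -/
def HasModularDiffEq (m : ℚ) (k : ℤ) (r : ℕ) (φ : ℍ → ℂ → ℂ) : Prop :=
  ∃ (w : ℤ) (f : (j : ℕ) → ModularForm 𝒮ℒ (w - 2 * (j : ℤ))),
    f r ≠ 0 ∧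
      ∀ (τ : ℍ) (z : ℂ), ∑ j ∈ Finset.range (r + 1), f j τ * modHeatIter m k φ j τ z = 0

end JacobiMDE

end

/-!
The lattice `ℤτ + ℤ` has a Weierstrass function, normalized here to `wp = ℘ / (2πi)²`, and all
quasi-periodic objects in sight are expressed through it. Two facts about `ϑ` make this possible.
By the product expansion the zeros of `ϑ` are exactly the lattice points, and they are simple; so by
Liouville's theorem `-∂_z² log ϑ = wp + c` for a constant `c` (`thetaP_eq`), where derivatives are
normalized by `(2πi)⁻¹`. The addition formula for `ϑ(x + y) ϑ(x - y)` (`theta_add_mul_theta_sub`),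
again from Liouville's theorem, gives the duplication and triplication formulas, and hence
`φ_{0,3} = (4 wp³ - g₂ wp - g₃) X³` and `φ_{0,4} = (3 wp⁴ - (3/2) g₂ wp² - 3 g₃ wp - g₂²/16) X⁴`
with `X = ϑ(z)² / ϑ'(0)²`. With `Y = wp X`, which is entire, both are forms in `X` and `Y` whose
coefficients are polynomials in `g₂ = E₄/12` and `g₃ = -E₆/216` (`phiZeroThree_eq`,
`phiZeroFour_eq`).

The modular derivatives come from the heat equation `∂_τ ϑ = ½ ∂_z² ϑ`. Applied to the Weierstrass
equation `wp'² = 4 wp³ - g₂ wp - g₃` it yields a polynomial equation for `wp` whose coefficients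
have to vanish; this is Ramanujan's system for the derivatives of `c`, `g₂` and `g₃` (`ramanujan`).
Comparing with the discriminant, whose logarithmic derivative is `E₂`, one finds `c = -E₂/12`
(`thetaC_eq`). The same calculus gives the images of `X` and `Y` under the heat operator
(`heat_jacX`, `heat_jacY`) and their second Hirota derivatives (`hirota_jac`) as forms in `X` and
`Y`. Consequently `H_k` maps forms of degree `m` in `X` and `Y` to such forms, by explicit formulas
in which `E₂` cancels (`modHeat_cubic`, `modHeat_quartic`).

For `φ_{0,3}` and `φ_{0,4}` the iterates of `H` are computed this way, and the two differential
equations become polynomial identities in `E₄` and `E₆`, since `E₈ = E₄²`. As `wp` takes infinitely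
many values, `X³, X²Y, XY², Y³` are linearly independent for each `τ`. The coefficient vectors of
`φ_{0,3}`, `H_0 φ_{0,3}`, `H_2 H_0 φ_{0,3}` and `H_4 H_2 H_0 φ_{0,3}` have determinant
`(5/432) (E₄³ - E₆²)²`, which vanishes nowhere on the upper half-plane, so they satisfy no linear
relation and there is no equation of order three.
-/

noncomputable section

namespace JacobiMDE

open UpperHalfPlane hiding I
open Filter Topology Complex
open scoped Real

/-! ### Theta series with polynomial weights -/

/-- The `n`-th term of `thetaD k`. -/
def thetaTerm (k : ℕ) (n : ℤ) (τ z : ℂ) : ℂ :=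
  ((n : ℂ) + 1 / 2) ^ k * (-1) ^ n *
    cexp (2 * π * I * (((n : ℂ) + 1 / 2) ^ 2 / 2 * τ + ((n : ℂ) + 1 / 2) * z))

/-- The theta series `∑ (-1)^n (n + 1/2)^k q^((n + 1/2)²/2) ζ^(n + 1/2)`, that is, the `k`-th
derivative of `ϑ` under `(2πi)⁻¹ ∂/∂z`, as a function of two complex variables. -/
def thetaD (k : ℕ) (τ z : ℂ) : ℂ := ∑' n : ℤ, thetaTerm k n τ z

/-- A summable majorant of the terms of `thetaD k` on `T ≤ im τ`, `|im z| ≤ S`. -/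
def thetaBound (k : ℕ) (S T : ℝ) (n : ℤ) : ℝ :=
  2 ^ (k - 1) * (|(n : ℝ)| ^ k + 1) * rexp (2 * π * S) *
    rexp (-π * (T * n ^ 2 - 2 * (S + T / 2) * |(n : ℝ)|))

lemma summable_thetaBound (k : ℕ) (S : ℝ) {T : ℝ} (hT : 0 < T) :
    Summable (thetaBound k S T) := by
  have h1 := summable_pow_mul_jacobiTheta₂_term_bound (S + T / 2) hT k
  have h2 := summable_pow_mul_jacobiTheta₂_term_bound (S + T / 2) hT 0
  refine ((h1.add h2).mul_left (2 ^ (k - 1) * rexp (2 * π * S))).congr fun n ↦ ?_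
  simp only [thetaBound, Int.cast_abs, pow_zero]
  ring

lemma norm_thetaTerm (k : ℕ) (n : ℤ) (τ z : ℂ) :
    ‖thetaTerm k n τ z‖ = |(n : ℝ) + 1 / 2| ^ k *
      rexp (-π * (((n : ℝ) + 1 / 2) ^ 2 * τ.im + 2 * ((n : ℝ) + 1 / 2) * z.im)) := by
  have h1 : ‖(n : ℂ) + 1 / 2‖ = |(n : ℝ) + 1 / 2| := by
    rw [show (n : ℂ) + 1 / 2 = (((n : ℝ) + 1 / 2 : ℝ) : ℂ) by push_cast; ring, Complex.norm_real,
      Real.norm_eq_abs]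
  have h2 : (2 * π * I * (((n : ℂ) + 1 / 2) ^ 2 / 2 * τ + ((n : ℂ) + 1 / 2) * z)) =
      ((π * ((n : ℝ) + 1 / 2) ^ 2 : ℝ) : ℂ) * τ * I +
        ((2 * π * ((n : ℝ) + 1 / 2) : ℝ) : ℂ) * z * I := by
    push_cast; ring
  rw [thetaTerm, norm_mul, norm_mul, norm_pow, h1, norm_zpow, norm_neg, norm_one, one_zpow, mul_one,
    Complex.norm_exp, h2, add_re, mul_I_re, im_ofReal_mul, mul_I_re, im_ofReal_mul]
  ring_nf

lemma norm_thetaTerm_le (k : ℕ) {S T : ℝ} (hT : 0 < T) {τ z : ℂ} (hz : |z.im| ≤ S)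
    (hτ : T ≤ τ.im) (n : ℤ) : ‖thetaTerm k n τ z‖ ≤ thetaBound k S T n := by
  have hS : 0 ≤ S := (abs_nonneg _).trans hz
  have hle : |(n : ℝ) + 1 / 2| ≤ |(n : ℝ)| + 1 :=
    (abs_add_le _ _).trans (by rw [abs_of_pos (by norm_num : (0 : ℝ) < 1 / 2)]; linarith)
  have hn := abs_nonneg (n : ℝ)
  rw [norm_thetaTerm, thetaBound, mul_assoc (_ * _), ← Real.exp_add]
  refine mul_le_mul ?_ (Real.exp_le_exp.mpr ?_) (Real.exp_pos _).le (by positivity)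
  · calc |(n : ℝ) + 1 / 2| ^ k ≤ (|(n : ℝ)| + 1) ^ k := by gcongr
      _ ≤ 2 ^ (k - 1) * (|(n : ℝ)| ^ k + 1 ^ k) := add_pow_le hn zero_le_one k
      _ = _ := by rw [one_pow]
  · have h1 : ((n : ℝ) + 1 / 2) ^ 2 * T ≤ ((n : ℝ) + 1 / 2) ^ 2 * τ.im := by gcongr
    have h2 : -(((n : ℝ) + 1 / 2) * z.im) ≤ (|(n : ℝ)| + 1) * S := by
      refine (neg_le_abs _).trans ?_
      rw [abs_mul]
      gcongr
    have h3 : T * ((n : ℝ) ^ 2 - |(n : ℝ)|) ≤ ((n : ℝ) + 1 / 2) ^ 2 * T := by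
      nlinarith [neg_abs_le (n : ℝ)]
    have := Real.pi_pos
    nlinarith

lemma summable_thetaTerm (k : ℕ) {τ : ℂ} (hτ : 0 < τ.im) (z : ℂ) :
    Summable fun n ↦ thetaTerm k n τ z :=
  .of_norm_bounded (summable_thetaBound k |z.im| hτ)
    fun n ↦ norm_thetaTerm_le k hτ le_rfl le_rfl n

lemma hasDerivAt_thetaTerm_z (k : ℕ) (n : ℤ) (τ z : ℂ) :
    HasDerivAt (fun w ↦ thetaTerm k n τ w) (2 * π * I * thetaTerm (k + 1) n τ z) z := by
  have h := ((((hasDerivAt_id z).const_mul ((n : ℂ) + 1 / 2)).const_add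
    (((n : ℂ) + 1 / 2) ^ 2 / 2 * τ)).const_mul (2 * π * I)).cexp.const_mul
      (((n : ℂ) + 1 / 2) ^ k * (-1) ^ n)
  refine h.congr_deriv ?_
  simp only [thetaTerm, id]
  ring

lemma hasDerivAt_thetaTerm_tau (k : ℕ) (n : ℤ) (τ z : ℂ) :
    HasDerivAt (fun w ↦ thetaTerm k n w z) (2 * π * I * (1 / 2 * thetaTerm (k + 2) n τ z)) τ := by
  have h := ((((hasDerivAt_id τ).const_mul (((n : ℂ) + 1 / 2) ^ 2 / 2)).add_const
    (((n : ℂ) + 1 / 2) * z)).const_mul (2 * π * I)).cexp.const_mul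
      (((n : ℂ) + 1 / 2) ^ k * (-1) ^ n)
  refine h.congr_deriv ?_
  simp only [thetaTerm, id]
  ring

lemma norm_two_pi_I : ‖(2 * π * I : ℂ)‖ = 2 * π := by
  simp [abs_of_pos Real.pi_pos]

lemma hasDerivAt_thetaD_z (k : ℕ) {τ : ℂ} (hτ : 0 < τ.im) (z : ℂ) :
    HasDerivAt (thetaD k τ) (2 * π * I * thetaD (k + 1) τ z) z := by
  have hu := (summable_thetaBound (k + 1) (|z.im| + 1) hτ).mul_left (2 * π)
  have := hasDerivAt_tsum_of_isPreconnected hu (Metric.isOpen_ball (x := z) (ε := 1))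
    (convex_ball z 1).isPreconnected (fun n y _ ↦ hasDerivAt_thetaTerm_z k n τ y)
    (fun n y hy ↦ ?_) (Metric.mem_ball_self one_pos) (summable_thetaTerm k hτ z)
    (Metric.mem_ball_self one_pos)
  · rwa [tsum_mul_left] at this
  · rw [norm_mul, norm_two_pi_I]
    refine mul_le_mul_of_nonneg_left (norm_thetaTerm_le _ hτ ?_ le_rfl n) Real.two_pi_pos.le
    have h1 : |(y - z).im| < 1 := (abs_im_le_norm _).trans_lt (mem_ball_iff_norm.mp hy)
    calc |y.im| = |(y - z).im + z.im| := by simp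
      _ ≤ _ := (abs_add_le _ _).trans (by linarith)

/-- The heat equation for `ϑ` and its derivatives. -/
lemma hasDerivAt_thetaD_tau (k : ℕ) {τ : ℂ} (hτ : 0 < τ.im) (z : ℂ) :
    HasDerivAt (fun w ↦ thetaD k w z) (2 * π * I * (1 / 2 * thetaD (k + 2) τ z)) τ := by
  have hT : 0 < τ.im / 2 := by positivity
  have hu := (summable_thetaBound (k + 2) |z.im| hT).mul_left (2 * π)
  have := hasDerivAt_tsum_of_isPreconnected hu (Metric.isOpen_ball (x := τ) (ε := τ.im / 2))
    (convex_ball τ _).isPreconnected (fun n y _ ↦ hasDerivAt_thetaTerm_tau k n y z)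
    (fun n y hy ↦ ?_) (Metric.mem_ball_self hT) (summable_thetaTerm k hτ z)
    (Metric.mem_ball_self hT)
  · rwa [tsum_mul_left, tsum_mul_left] at this
  · rw [norm_mul, norm_two_pi_I, norm_mul]
    have h1 : |(y - τ).im| < τ.im / 2 := (abs_im_le_norm _).trans_lt (mem_ball_iff_norm.mp hy)
    have h2 := norm_thetaTerm_le (k + 2) hT (τ := y) (z := z) le_rfl
      (by rw [sub_im, abs_lt] at h1; linarith) n
    refine mul_le_mul_of_nonneg_left (le_trans ?_ h2) Real.two_pi_pos.le
    refine mul_le_of_le_one_left (norm_nonneg _) (by norm_num)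

lemma differentiable_thetaD (k : ℕ) {τ : ℂ} (hτ : 0 < τ.im) : Differentiable ℂ (thetaD k τ) :=
  fun z ↦ (hasDerivAt_thetaD_z k hτ z).differentiableAt

lemma theta_eq_thetaD (τ : ℍ) (z : ℂ) : theta τ z = thetaD 0 τ z := by
  rw [theta, thetaD, ← tsum_mul_left]
  refine tsum_congr fun n ↦ ?_
  have h : 2 * π * I * (((n : ℂ) + 1 / 2) ^ 2 / 2 * τ + ((n : ℂ) + 1 / 2) * z) =
      2 * π * I * (τ / 8) + 2 * π * I * (z / 2) + 2 * π * I * (n * (n + 1) / 2 * τ) +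
        2 * π * I * (n * z) := by ring
  rw [thetaTerm, h, Complex.exp_add, Complex.exp_add, Complex.exp_add]
  ring

/-! ### Parity and quasi-periodicity -/

lemma thetaD_neg (k : ℕ) (τ z : ℂ) : thetaD k τ (-z) = (-1) ^ (k + 1) * thetaD k τ z := by
  rw [thetaD, ← (Equiv.subLeft (-1 : ℤ)).tsum_eq, thetaD, ← tsum_mul_left]
  refine tsum_congr fun n ↦ ?_
  have h1 : ((-1 : ℂ)) ^ (-1 - n : ℤ) = -(-1) ^ n := by
    rcases Int.even_or_odd n with hn | hn
    · rw [hn.neg_one_zpow, (show Odd (-1 - n) by grind).neg_one_zpow]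
    · rw [hn.neg_one_zpow, (show Even (-1 - n) by grind).neg_one_zpow, neg_neg]
  simp only [thetaTerm, Equiv.subLeft_apply, h1]
  push_cast
  have h2 : (-1 - (n : ℂ) + 1 / 2) = -((n : ℂ) + 1 / 2) := by ring
  rw [h2, neg_pow ((n : ℂ) + 1 / 2) k, neg_sq, pow_succ, neg_mul_neg]
  ring

lemma theta_add_one (τ z : ℂ) : thetaD 0 τ (z + 1) = -thetaD 0 τ z := by
  rw [thetaD, thetaD, ← tsum_neg]
  refine tsum_congr fun n ↦ ?_
  have h : (2 * π * I * (((n : ℂ) + 1 / 2) ^ 2 / 2 * τ + ((n : ℂ) + 1 / 2) * (z + 1))) =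
      2 * π * I * (((n : ℂ) + 1 / 2) ^ 2 / 2 * τ + ((n : ℂ) + 1 / 2) * z) +
        (n * (2 * π * I) + π * I) := by ring
  rw [thetaTerm, thetaTerm, h, Complex.exp_add _ (_ + _), Complex.exp_add (n * _),
    Complex.exp_int_mul_two_pi_mul_I, Complex.exp_pi_mul_I]
  ring

lemma theta_add_tau (τ z : ℂ) :
    thetaD 0 τ (z + τ) = -cexp (-(2 * π * I * (τ / 2 + z))) * thetaD 0 τ z := by
  rw [thetaD, ← (Equiv.subRight (1 : ℤ)).tsum_eq, thetaD, ← tsum_mul_left]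
  refine tsum_congr fun n ↦ ?_
  have h : (-1 : ℂ) ^ (n - 1) = -(-1) ^ n := by
    rw [zpow_sub₀ (by norm_num)]; simp [div_neg]
  simp only [thetaTerm, Equiv.subRight_apply, h, pow_zero, one_mul, neg_mul]
  rw [mul_left_comm, ← Complex.exp_add]
  push_cast
  ring_nf

/-! ### Elliptic functions without poles -/

section Elliptic

variable {L : PeriodPair}

lemma periodic_of_generators {h : ℂ → ℂ} (h₁ : ∀ z ∉ L.lattice, h (z + L.ω₁) = h z)
    (h₂ : ∀ z ∉ L.lattice, h (z + L.ω₂) = h z) {z l : ℂ} (hz : z ∉ L.lattice)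
    (hl : l ∈ L.lattice) : h (z + l) = h z := by
  have hadd : ∀ {z l : ℂ}, z ∉ L.lattice → l ∈ L.lattice → z + l ∉ L.lattice :=
    fun hz hl hzl ↦ hz (by simpa using L.lattice.sub_mem hzl hl)
  have key : ∀ {ω : ℂ}, ω ∈ L.lattice → (∀ z ∉ L.lattice, h (z + ω) = h z) →
      ∀ m : ℤ, ∀ z ∉ L.lattice, h (z + m * ω) = h z := by
    intro ω hω hp m
    have hmem (k : ℤ) : (k : ℂ) * ω ∈ L.lattice := by
      simpa using L.lattice.smul_mem k hω
    induction m using Int.induction_on with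
    | zero => simp
    | succ i ih =>
      intro z hz
      rw [show z + ((i + 1 : ℤ) : ℂ) * ω = z + (i : ℤ) * ω + ω by push_cast; ring,
        hp _ (hadd hz (hmem i)), ih z hz]
    | pred i ih =>
      intro z hz
      rw [← hp _ (hadd hz (hmem _)), ← ih z hz]
      congr 1
      push_cast
      ring
  obtain ⟨m, n, rfl⟩ := PeriodPair.mem_lattice.mp hl
  have hm : (m : ℂ) * L.ω₁ ∈ L.lattice := by simpa using L.lattice.smul_mem m L.ω₁_mem_lattice
  rw [← add_assoc, key L.ω₂_mem_lattice h₂ n _ (hadd hz hm), key L.ω₁_mem_lattice h₁ m z hz]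

/-- Liouville's theorem for an elliptic function all of whose singularities are removable. -/
lemma eq_of_periodic_of_removable {h g : ℂ → ℂ} (hd : DifferentiableOn ℂ h (L.lattice : Set ℂ)ᶜ)
    (h₁ : ∀ z ∉ L.lattice, h (z + L.ω₁) = h z) (h₂ : ∀ z ∉ L.lattice, h (z + L.ω₂) = h z)
    (hg : AnalyticAt ℂ g 0) (hgh : ∀ᶠ z in 𝓝[≠] 0, h z = g z) {z : ℂ} (hz : z ∉ L.lattice) :
    h z = g 0 := by
  classical
  have hadd : ∀ {z l : ℂ}, l ∈ L.lattice → (z + l ∈ L.lattice ↔ z ∈ L.lattice) :=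
    fun hl ↦ ⟨fun hzl ↦ by simpa using L.lattice.sub_mem hzl hl, fun hz ↦ L.lattice.add_mem hz hl⟩
  let H : ℂ → ℂ := fun z ↦ if z ∈ L.lattice then g 0 else h z
  have hper : ∀ z l, l ∈ L.lattice → H (z + l) = H z := by
    intro z l hl
    by_cases hz : z ∈ L.lattice
    · simp [H, hz, hadd hl]
    · simp only [H, hz, hadd hl, if_false]
      exact periodic_of_generators h₁ h₂ hz hl
  have hopen : IsOpen (L.lattice : Set ℂ)ᶜ := L.isClosed_lattice.isOpen_compl
  have hzero : DifferentiableAt ℂ H 0 := by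
    refine hg.differentiableAt.congr_of_eventuallyEq ?_
    have := L.compl_lattice_sdiff_singleton_mem_nhds 0
    rw [eventually_nhdsWithin_iff] at hgh
    filter_upwards [this, hgh] with w hw hw'
    by_cases hw0 : w = 0
    · simp [H, hw0]
    · have : w ∉ L.lattice := by simpa [hw0] using hw
      simp [H, this, hw' hw0]
  have hH : Differentiable ℂ H := by
    intro w
    by_cases hw : w ∈ L.lattice
    · have h0 : DifferentiableAt ℂ H (w - w) := by simpa using hzero
      have := h0.comp w (f := fun x ↦ x - w) (by fun_prop)
      refine this.congr_of_eventuallyEq (.of_forall fun x ↦ ?_)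
      simpa using hper (x - w) w hw
    · refine (hd.differentiableAt (hopen.mem_nhds hw)).congr_of_eventuallyEq ?_
      filter_upwards [hopen.mem_nhds hw] with x hx
      have : x ∉ L.lattice := hx
      simp [H, this]
  have hb := (IsZLattice.isCompact_range_of_periodic L.lattice H hH.continuous
    (fun z w hw ↦ hper z w hw)).isBounded
  have := hH.apply_eq_apply_of_bounded hb z 0
  simpa [H, hz] using this

lemma dense_compl_lattice : Dense (L.lattice : Set ℂ)ᶜ :=
  (Set.countable_coe_iff.mp (inferInstanceAs (Countable L.lattice))).dense_compl ℝ

/-- Continuous functions that agree off a lattice are equal. -/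
lemma eq_of_eqOn_compl_lattice {f g : ℂ → ℂ} (hf : Continuous f) (hg : Continuous g)
    (h : ∀ z ∉ L.lattice, f z = g z) (z : ℂ) : f z = g z :=
  congr_fun (Continuous.ext_on dense_compl_lattice hf hg fun z hz ↦ h z hz) z

end Elliptic

/-- The period pair `(τ, 1)`. -/
def periodPair (τ : ℍ) : PeriodPair where
  ω₁ := τ
  ω₂ := 1
  indep := by
    rw [LinearIndependent.pair_iff]
    intro s t h
    have him := congr_arg Complex.im h
    have hre := congr_arg Complex.re h
    have : s * τ.im = 0 := by simpa using him
    have hs : s = 0 := (mul_eq_zero.mp this).resolve_right τ.im_pos.ne'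
    simp [hs] at hre
    exact ⟨hs, hre⟩

lemma mem_lattice_periodPair {τ : ℍ} {z : ℂ} :
    z ∈ (periodPair τ).lattice ↔ ∃ m n : ℤ, (m : ℂ) * τ + n = z := by
  simp [PeriodPair.mem_lattice, periodPair]

/-! ### The zeros of the theta function -/

/-- The Euler product `∏ (1 - q^(n+1) w)`. -/
def eulerProd (q w : ℂ) : ℂ := ∏' n : ℕ, (1 - q ^ (n + 1) * w)

section EulerProd

variable {q : ℂ}

lemma summable_eulerProd (hq : ‖q‖ < 1) (w : ℂ) : Summable fun n : ℕ ↦ ‖-(q ^ (n + 1) * w)‖ := by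
  simp only [norm_neg, norm_mul, norm_pow]
  exact ((summable_nat_add_iff 1).mpr
    (summable_geometric_of_lt_one (norm_nonneg q) hq)).mul_right ‖w‖

lemma multipliable_eulerProd (hq : ‖q‖ < 1) (w : ℂ) :
    Multipliable fun n : ℕ ↦ 1 - q ^ (n + 1) * w := by
  simpa [sub_eq_add_neg] using multipliable_one_add_of_summable (summable_eulerProd hq w)

lemma differentiable_eulerProd (hq : ‖q‖ < 1) : Differentiable ℂ (eulerProd q) := by
  rw [← differentiableOn_univ]
  have h : HasProdLocallyUniformlyOn (fun (n : ℕ) w ↦ 1 + -(q ^ (n + 1) * w))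
      (fun w ↦ ∏' n : ℕ, (1 + -(q ^ (n + 1) * w))) Set.univ := by
    refine hasProdLocallyUniformlyOn_of_forall_compact isOpen_univ fun K _ hK ↦ ?_
    obtain ⟨r, hr⟩ := hK.isBounded.exists_norm_le
    refine ((summable_nat_add_iff 1).mpr (summable_geometric_of_lt_one (norm_nonneg q)
      hq) |>.mul_right r).hasProdUniformlyOn_nat_one_add hK (.of_forall fun n x hx ↦ ?_)
      (fun n ↦ by fun_prop)
    rw [norm_neg, norm_mul, norm_pow]
    gcongr
    exact hr x hx
  have := h.differentiableOn (.of_forall fun _ ↦ by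
    simpa [Finset.prod_fn] using DifferentiableOn.finsetProd (fun _ _ ↦ by fun_prop)) isOpen_univ
  refine this.congr fun w _ ↦ ?_
  simp [eulerProd, sub_eq_add_neg]

lemma eulerProd_eq_mul (hq : ‖q‖ < 1) (w : ℂ) :
    eulerProd q w = (1 - q * w) * eulerProd q (q * w) := by
  have h1 : Tendsto (fun N ↦ ∏ n ∈ Finset.range (N + 1), (1 - q ^ (n + 1) * w)) atTop
      (𝓝 (eulerProd q w)) :=
    (multipliable_eulerProd hq w).hasProd.tendsto_prod_nat.comp (tendsto_add_atTop_nat 1)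
  have h2 := ((multipliable_eulerProd hq (q * w)).hasProd.tendsto_prod_nat).const_mul (1 - q * w)
  refine tendsto_nhds_unique h1 (h2.congr fun N ↦ ?_)
  rw [Finset.prod_range_succ', zero_add, pow_one, mul_comm]
  congr 1
  exact Finset.prod_congr rfl fun n _ ↦ by ring

lemma eulerProd_ne_zero (hq : ‖q‖ < 1) {w : ℂ} (hw : ∀ n : ℕ, q ^ (n + 1) * w ≠ 1) :
    eulerProd q w ≠ 0 := by
  have := tprod_one_add_ne_zero_of_summable (f := fun n : ℕ ↦ -(q ^ (n + 1) * w))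
    (fun n ↦ by rw [← sub_eq_add_neg]; exact sub_ne_zero.mpr (hw n).symm) (summable_eulerProd hq w)
  simpa [eulerProd, sub_eq_add_neg] using this

end EulerProd

/-- The nome `q = exp (2πiτ)`. -/
def nome (τ : ℍ) : ℂ := cexp (2 * π * I * τ)

lemma norm_nome_lt_one (τ : ℍ) : ‖nome τ‖ < 1 := norm_exp_two_pi_I_lt_one τ

/-- The part of the product expansion of the theta function that does not vanish at `0`. -/
def thetaProdTail (τ : ℍ) (z : ℂ) : ℂ :=
  eulerProd (nome τ) (cexp (2 * π * I * z)) * eulerProd (nome τ) (cexp (-(2 * π * I * z)))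

/-- `(ζ^(1/2) - ζ^(-1/2)) ∏ (1 - q^n ζ) (1 - q^n ζ⁻¹)`, proportional to the theta function. -/
def thetaProd (τ : ℍ) (z : ℂ) : ℂ :=
  (cexp (π * I * z) - cexp (-(π * I * z))) * thetaProdTail τ z

lemma differentiable_thetaProdTail (τ : ℍ) : Differentiable ℂ (thetaProdTail τ) := by
  have := differentiable_eulerProd (norm_nome_lt_one τ)
  unfold thetaProdTail
  exact (this.comp (by fun_prop)).mul (this.comp (by fun_prop))

lemma differentiable_thetaProd (τ : ℍ) : Differentiable ℂ (thetaProd τ) := by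
  have := differentiable_thetaProdTail τ
  unfold thetaProd
  fun_prop

lemma thetaProd_add_one (τ : ℍ) (z : ℂ) : thetaProd τ (z + 1) = -thetaProd τ z := by
  have h1 : cexp (2 * π * I * (z + 1)) = cexp (2 * π * I * z) := by
    rw [mul_add, mul_one, Complex.exp_add, Complex.exp_two_pi_mul_I, mul_one]
  have h2 : cexp (π * I * (z + 1)) = -cexp (π * I * z) := by
    rw [mul_add, mul_one, Complex.exp_add, Complex.exp_pi_mul_I, mul_neg_one]
  simp only [thetaProd, thetaProdTail, Complex.exp_neg, h1, h2, inv_neg]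
  ring

lemma thetaProd_add_tau (τ : ℍ) (z : ℂ) :
    thetaProd τ (z + τ) = -cexp (-(2 * π * I * ((τ : ℂ) / 2 + z))) * thetaProd τ z := by
  have hq := norm_nome_lt_one τ
  -- the two functional equations `G(w) = (1 - q w) G(q w)`, at `w = ζ` and at `w = q⁻¹ ζ⁻¹`
  have h1 := eulerProd_eq_mul hq (cexp (2 * π * I * z))
  have h2 := eulerProd_eq_mul hq (cexp (-(2 * π * I * (z + τ))))
  have e1 : nome τ * cexp (2 * π * I * z) = cexp (2 * π * I * (z + τ)) := by
    rw [nome, ← Complex.exp_add]; ring_nf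
  have e2 : nome τ * cexp (-(2 * π * I * (z + τ))) = cexp (-(2 * π * I * z)) := by
    rw [nome, ← Complex.exp_add]; ring_nf
  rw [e1] at h1
  rw [e2] at h2
  simp only [thetaProd, thetaProdTail]
  rw [h1, h2]
  have e3 : (cexp (π * I * (z + τ)) - cexp (-(π * I * (z + τ)))) * (1 - cexp (-(2 * π * I * z))) =
      -cexp (-(2 * π * I * ((τ : ℂ) / 2 + z))) * ((cexp (π * I * z) - cexp (-(π * I * z))) *
        (1 - cexp (2 * π * I * (z + τ)))) := by
    simp only [mul_sub, sub_mul, neg_mul, mul_one, ← Complex.exp_add]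
    ring_nf
  linear_combination (eulerProd (nome τ) (cexp (2 * π * I * (z + τ))) *
    eulerProd (nome τ) (cexp (-(2 * π * I * z)))) * e3

lemma exp_two_pi_mul_I_eq_one {w : ℂ} (h : cexp (2 * π * I * w) = 1) : ∃ n : ℤ, w = n := by
  obtain ⟨n, hn⟩ := Complex.exp_eq_one_iff.mp h
  exact ⟨n, mul_left_cancel₀ two_pi_I_ne_zero (by rw [hn]; ring)⟩

lemma thetaProd_ne_zero {τ : ℍ} {z : ℂ} (hz : z ∉ (periodPair τ).lattice) : thetaProd τ z ≠ 0 := by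
  have hq := norm_nome_lt_one τ
  have key (m : ℕ) (s : ℂ) (hs : s = z ∨ s = -z) : nome τ ^ m * cexp (2 * π * I * s) ≠ 1 := by
    intro h
    rw [nome, ← Complex.exp_nat_mul, ← Complex.exp_add,
      show (m : ℂ) * (2 * π * I * τ) + 2 * π * I * s = 2 * π * I * (m * τ + s) by ring] at h
    obtain ⟨n, hn⟩ := exp_two_pi_mul_I_eq_one h
    refine hz (mem_lattice_periodPair.mpr ?_)
    rcases hs with rfl | rfl
    · exact ⟨-m, n, by push_cast; linear_combination hn.symm⟩
    · exact ⟨m, -n, by push_cast; linear_combination hn⟩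
  refine mul_ne_zero ?_ (mul_ne_zero (eulerProd_ne_zero hq fun n ↦ key _ _ (.inl rfl))
    (eulerProd_ne_zero hq fun n ↦ ?_))
  · intro h
    refine key 0 z (.inl rfl) ?_
    rw [pow_zero, one_mul, show 2 * π * I * z = π * I * z + π * I * z by ring, Complex.exp_add]
    nth_rewrite 2 [sub_eq_zero.mp h]
    rw [← Complex.exp_add, add_neg_cancel, Complex.exp_zero]
  · have := key (n + 1) (-z) (.inr rfl)
    rwa [mul_neg] at this

lemma thetaProdTail_zero_ne_zero (τ : ℍ) : thetaProdTail τ 0 ≠ 0 := by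
  have hq := norm_nome_lt_one τ
  have : eulerProd (nome τ) 1 ≠ 0 := by
    refine eulerProd_ne_zero hq fun n h ↦ ?_
    have h1 : ‖nome τ‖ ^ (n + 1) = 1 := by
      rw [← norm_pow, ← mul_one (nome τ ^ (n + 1)), h, norm_one]
    exact (pow_lt_one₀ (norm_nonneg _) hq n.succ_ne_zero).ne h1
  simp [thetaProdTail, this]

/-- The theta function does not vanish identically: its coefficient at `ζ^(1/2)` is
`exp (πiτ/4)`. -/
lemma exists_thetaD_zero_ne_zero (τ : ℍ) : ∃ z, thetaD 0 τ z ≠ 0 := by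
  by_contra! h0
  have hcont (n : ℤ) : Continuous fun x : ℝ ↦ thetaTerm 0 n τ x * cexp (-(π * I * x)) := by
    unfold thetaTerm; fun_prop
  have hnorm (x : ℝ) : ‖cexp (-(π * I * x))‖ = 1 := by
    rw [show -(π * I * x) = ((-(π * x) : ℝ) : ℂ) * I by push_cast; ring, norm_exp_ofReal_mul_I]
  have hs := intervalIntegral.hasSum_intervalIntegral_of_summable_norm (a := 0) (b := 1)
    (f := fun n : ℤ ↦ ⟨fun x : ℝ ↦ thetaTerm 0 n τ x * cexp (-(π * I * x)), hcont n⟩) ?_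
  · have hz : ∀ x : ℝ, ∑' n : ℤ, thetaTerm 0 n τ x * cexp (-(π * I * x)) = 0 := fun x ↦ by
      rw [tsum_mul_right, ← thetaD, h0, zero_mul]
    have hterm (n : ℤ) (x : ℝ) : thetaTerm 0 n τ x * cexp (-(π * I * x)) =
        (-1) ^ n * cexp (π * I * (n + 1 / 2) ^ 2 * τ) * cexp ((2 * π * I * n) * x) := by
      rw [thetaTerm, pow_zero, one_mul, mul_assoc ((-1 : ℂ) ^ n) _ _, mul_assoc ((-1 : ℂ) ^ n) _ _,
        ← Complex.exp_add, ← Complex.exp_add]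
      ring_nf
    have hint (n : ℤ) (hn : n ≠ 0) :
        ∫ x in (0 : ℝ)..1, thetaTerm 0 n τ x * cexp (-(π * I * x)) = 0 := by
      have hne : 2 * π * I * n ≠ 0 := mul_ne_zero two_pi_I_ne_zero (Int.cast_ne_zero.mpr hn)
      simp_rw [hterm]
      rw [intervalIntegral.integral_const_mul, integral_exp_mul_complex hne]
      rw [ofReal_one, mul_one, mul_comm (2 * π * I) (n : ℂ), Complex.exp_int_mul_two_pi_mul_I]
      simp
    have h1 := hs.unique (hasSum_single 0 fun n hn ↦ hint n hn)
    simp only [ContinuousMap.coe_mk, hz] at h1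
    simp [hterm] at h1
    exact Complex.exp_ne_zero _ h1.symm
  · refine .of_nonneg_of_le (fun _ ↦ norm_nonneg _) (fun n ↦ ?_)
      (summable_thetaBound 0 0 τ.im_pos)
    refine (ContinuousMap.norm_le _ ?_).mpr fun x ↦ ?_
    · unfold thetaBound; positivity
    · simp only [ContinuousMap.restrict_apply, ContinuousMap.coe_mk]
      rw [norm_mul, hnorm, mul_one]
      exact norm_thetaTerm_le 0 τ.im_pos (by simp) le_rfl n

lemma thetaD_zero_zero (τ : ℂ) {k : ℕ} (hk : Even k) : thetaD k τ 0 = 0 := by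
  have := thetaD_neg k τ 0
  rw [neg_zero, pow_succ, hk.neg_one_pow, one_mul, neg_one_mul] at this
  exact self_eq_neg.mp this

lemma eventually_notMem_lattice (L : PeriodPair) : ∀ᶠ z in 𝓝[≠] (0 : ℂ), z ∉ L.lattice := by
  rw [eventually_nhdsWithin_iff]
  filter_upwards [L.compl_lattice_sdiff_singleton_mem_nhds 0] with w hw hw0
  have : w ≠ 0 := hw0
  simpa [this] using hw

lemma differentiable_dslope {f : ℂ → ℂ} (hf : Differentiable ℂ f) (c : ℂ) :
    Differentiable ℂ (dslope f c) := by
  rw [← differentiableOn_univ] at hf ⊢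
  exact (Complex.differentiableOn_dslope univ_mem).mpr hf

/-- The theta function is proportional to its product expansion. -/
lemma exists_thetaD_eq_mul_thetaProd (τ : ℍ) :
    ∃ K : ℂ, K ≠ 0 ∧ ∀ z, thetaD 0 τ z = K * thetaProd τ z := by
  set E : ℂ → ℂ := fun z ↦ cexp (π * I * z) - cexp (-(π * I * z)) with hE
  have hEd : Differentiable ℂ E := by fun_prop
  have hE0 : E 0 = 0 := by simp [E]
  have hE' : HasDerivAt E (2 * π * I) 0 := by
    have h1 := ((hasDerivAt_id (0 : ℂ)).const_mul (π * I)).cexp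
    have h2 := ((hasDerivAt_id (0 : ℂ)).const_mul (π * I)).neg.cexp
    refine (h1.sub h2).congr_deriv ?_
    simp; ring
  have hθ := differentiable_thetaD 0 τ.im_pos
  have hP := differentiable_thetaProd τ
  have hT := differentiable_thetaProdTail τ
  let g : ℂ → ℂ := fun z ↦ dslope (thetaD 0 τ) 0 z / (dslope E 0 z * thetaProdTail τ z)
  have hg : AnalyticAt ℂ g 0 := by
    refine ((differentiable_dslope hθ 0).analyticAt 0).div
      (((differentiable_dslope hEd 0).analyticAt 0).mul (hT.analyticAt 0)) ?_
    rw [dslope_same, hE'.deriv]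
    exact mul_ne_zero two_pi_I_ne_zero (thetaProdTail_zero_ne_zero τ)
  have hconst : ∀ z ∉ (periodPair τ).lattice, thetaD 0 τ z / thetaProd τ z = g 0 := by
    intro z hz
    refine eq_of_periodic_of_removable (L := periodPair τ)
      (h := fun z ↦ thetaD 0 τ z / thetaProd τ z) ?_ ?_ ?_ hg ?_ hz
    · exact hθ.differentiableOn.div hP.differentiableOn fun z hz ↦ thetaProd_ne_zero hz
    · intro z _
      change thetaD 0 τ (z + τ) / thetaProd τ (z + τ) = _
      rw [theta_add_tau, thetaProd_add_tau, mul_div_mul_left]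
      exact neg_ne_zero.mpr (Complex.exp_ne_zero _)
    · intro z _
      change thetaD 0 τ (z + 1) / thetaProd τ (z + 1) = _
      rw [theta_add_one, thetaProd_add_one, neg_div_neg_eq]
    · filter_upwards [self_mem_nhdsWithin] with z (hz : z ≠ 0)
      simp only [g, dslope_of_ne _ hz, slope_def_field, thetaProd,
        thetaD_zero_zero (τ : ℂ) (by decide : Even 0), hE0, sub_zero]
      simp only [E]
      rw [div_mul_eq_mul_div, div_div_div_cancel_right₀ hz]
  have hall : ∀ z, thetaD 0 τ z = g 0 * thetaProd τ z :=
    eq_of_eqOn_compl_lattice (L := periodPair τ) hθ.continuous (hP.continuous.const_mul _)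
      fun z hz ↦ by rw [← hconst z hz, div_mul_cancel₀ _ (thetaProd_ne_zero hz)]
  refine ⟨g 0, fun h ↦ ?_, hall⟩
  obtain ⟨z, hz⟩ := exists_thetaD_zero_ne_zero τ
  exact hz (by rw [hall, h, zero_mul])

lemma thetaD_zero_ne_zero {τ : ℍ} {z : ℂ} (hz : z ∉ (periodPair τ).lattice) :
    thetaD 0 τ z ≠ 0 := by
  obtain ⟨K, hK, h⟩ := exists_thetaD_eq_mul_thetaProd τ
  rw [h]
  exact mul_ne_zero hK (thetaProd_ne_zero hz)

/-- The zero of the theta function at the origin is simple. -/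
lemma thetaD_one_zero_ne_zero (τ : ℍ) : thetaD 1 τ 0 ≠ 0 := by
  obtain ⟨K, hK, h⟩ := exists_thetaD_eq_mul_thetaProd τ
  have h1 := hasDerivAt_thetaD_z 0 τ.im_pos 0
  have h2 : HasDerivAt (fun z ↦ K * thetaProd τ z) (K * (2 * π * I * thetaProdTail τ 0)) 0 := by
    have e1 := ((hasDerivAt_id (0 : ℂ)).const_mul (π * I)).cexp
    have e2 := ((hasDerivAt_id (0 : ℂ)).const_mul (π * I)).neg.cexp
    have e3 := (differentiable_thetaProdTail τ 0).hasDerivAt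
    refine (((e1.sub e2).mul e3).const_mul K).congr_deriv ?_
    simp only [id, mul_zero, Pi.neg_apply, Pi.sub_apply, neg_zero, Complex.exp_zero]
    ring
  rw [show thetaD 0 (τ : ℂ) = fun z ↦ K * thetaProd τ z from funext h] at h1
  intro h0
  have := h1.unique h2
  rw [zero_add, h0, mul_zero] at this
  exact mul_ne_zero hK (mul_ne_zero two_pi_I_ne_zero (thetaProdTail_zero_ne_zero τ)) this.symm

/-! ### Normalized derivatives -/

/-- `f` has derivative `f'` at `x` with respect to `(2πi)⁻¹ d/dx`. -/
def HasNDerivAt (f : ℂ → ℂ) (f' x : ℂ) : Prop := HasDerivAt f (2 * π * I * f') x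

namespace HasNDerivAt

variable {f g : ℂ → ℂ} {f' g' x : ℂ}

lemma congr_deriv (h : HasNDerivAt f f' x) (h' : f' = g') : HasNDerivAt f g' x := h' ▸ h

lemma unique (h : HasNDerivAt f f' x) (h' : HasNDerivAt f g' x) : f' = g' :=
  mul_left_cancel₀ two_pi_I_ne_zero (HasDerivAt.unique h h')

lemma congr_of_eventuallyEq (h : HasNDerivAt f f' x) (h' : g =ᶠ[𝓝 x] f) : HasNDerivAt g f' x :=
  HasDerivAt.congr_of_eventuallyEq h h'

lemma const (c x : ℂ) : HasNDerivAt (fun _ ↦ c) 0 x := by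
  simpa [HasNDerivAt] using hasDerivAt_const x c

lemma add (hf : HasNDerivAt f f' x) (hg : HasNDerivAt g g' x) :
    HasNDerivAt (fun y ↦ f y + g y) (f' + g') x :=
  (HasDerivAt.add hf hg).congr_deriv (by ring)

lemma sub (hf : HasNDerivAt f f' x) (hg : HasNDerivAt g g' x) :
    HasNDerivAt (fun y ↦ f y - g y) (f' - g') x :=
  (HasDerivAt.sub hf hg).congr_deriv (by ring)

lemma neg (hf : HasNDerivAt f f' x) : HasNDerivAt (fun y ↦ -f y) (-f') x :=
  (HasDerivAt.neg hf).congr_deriv (by ring)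

lemma mul (hf : HasNDerivAt f f' x) (hg : HasNDerivAt g g' x) :
    HasNDerivAt (fun y ↦ f y * g y) (f' * g x + f x * g') x :=
  (HasDerivAt.mul hf hg).congr_deriv (by ring)

lemma const_mul (c : ℂ) (hf : HasNDerivAt f f' x) : HasNDerivAt (fun y ↦ c * f y) (c * f') x :=
  (HasDerivAt.const_mul c hf).congr_deriv (by ring)

lemma div (hf : HasNDerivAt f f' x) (hg : HasNDerivAt g g' x) (h : g x ≠ 0) :
    HasNDerivAt (fun y ↦ f y / g y) ((f' * g x - f x * g') / g x ^ 2) x :=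
  (HasDerivAt.div hf hg h).congr_deriv (by ring)

lemma pow (hf : HasNDerivAt f f' x) (n : ℕ) :
    HasNDerivAt (fun y ↦ f y ^ n) (n * f x ^ (n - 1) * f') x :=
  (HasDerivAt.pow hf n).congr_deriv (by ring)

lemma comp_affine {a b : ℂ} (hf : HasNDerivAt f f' (a * x + b)) :
    HasNDerivAt (fun y ↦ f (a * y + b)) (a * f') x :=
  (HasDerivAt.comp (h₂ := f) (h := fun y ↦ a * y + b) x hf
    (((hasDerivAt_id x).const_mul a).add_const b)).congr_deriv (by ring)

end HasNDerivAt

lemma hasNDerivAt_thetaD (k : ℕ) (τ : ℍ) (z : ℂ) :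
    HasNDerivAt (thetaD k τ) (thetaD (k + 1) τ z) z := hasDerivAt_thetaD_z k τ.im_pos z

/-! ### The normalized Weierstrass function -/

/-- `℘ / (2πi)²` for the lattice `ℤτ + ℤ`. -/
def wp (τ : ℍ) (z : ℂ) : ℂ := (periodPair τ).weierstrassP z / (2 * π * I) ^ 2

/-- The derivative of `wp` under `(2πi)⁻¹ ∂/∂z`. -/
def wpDeriv (τ : ℍ) (z : ℂ) : ℂ := (periodPair τ).derivWeierstrassP z / (2 * π * I) ^ 3

/-- The invariant `g₂` of `ℤτ + ℤ`, normalized as in `wp`. -/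
def gTwo (τ : ℍ) : ℂ := (periodPair τ).g₂ / (2 * π * I) ^ 4

/-- The invariant `g₃` of `ℤτ + ℤ`, normalized as in `wp`. -/
def gThree (τ : ℍ) : ℂ := (periodPair τ).g₃ / (2 * π * I) ^ 6

section Weierstrass

variable (L : PeriodPair)

lemma derivWeierstrassP_eq_near_zero :
    ∀ᶠ z in 𝓝[≠] (0 : ℂ),
      L.derivWeierstrassP z * z ^ 3 = L.derivWeierstrassPExcept 0 z * z ^ 3 - 2 := by
  filter_upwards [self_mem_nhdsWithin] with z (hz : z ≠ 0)
  have := L.derivWeierstrassPExcept_def 0 z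
  simp only [ZeroMemClass.coe_zero, sub_zero] at this
  rw [this]
  field_simp
  ring

lemma isPreconnected_compl_lattice : IsPreconnected (L.lattice : Set ℂ)ᶜ := by
  refine (Set.Countable.isPathConnected_compl_of_one_lt_rank ?_
    (Set.countable_coe_iff.mp (inferInstanceAs (Countable L.lattice)))).isConnected.isPreconnected
  rw [Complex.rank_real_complex]
  norm_num

lemma derivWeierstrassP_eventually_ne_zero {z : ℂ} (hz : z ∉ L.lattice) :
    ∀ᶠ w in 𝓝[≠] z, L.derivWeierstrassP w ≠ 0 := by
  refine ((L.analyticOnNhd_derivWeierstrassP z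
      hz).eventually_eq_zero_or_eventually_ne_zero).resolve_left
    fun h ↦ ?_
  have h0 := L.analyticOnNhd_derivWeierstrassP.eqOn_zero_of_preconnected_of_eventuallyEq_zero
    (isPreconnected_compl_lattice L) hz h
  -- `℘'` cannot vanish identically, since `z³ ℘'(z)` tends to `-2` at the origin
  have h1 : Tendsto (fun z ↦ L.derivWeierstrassPExcept 0 z * z ^ 3 - 2) (𝓝[≠] 0) (𝓝 (-2)) := by
    have hc : ContinuousAt (fun z ↦ L.derivWeierstrassPExcept 0 z * z ^ 3 - 2) 0 :=
      ((L.analyticAt_derivWeierstrassPExcept 0).continuousAt.mul (by fun_prop)).sub (by fun_prop)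
    have := hc.tendsto.mono_left (nhdsWithin_le_nhds (s := {0}ᶜ))
    simpa using this
  have h2 : Tendsto (fun z ↦ L.derivWeierstrassPExcept 0 z * z ^ 3 - 2) (𝓝[≠] 0) (𝓝 0) := by
    refine tendsto_const_nhds.congr' ?_
    filter_upwards [derivWeierstrassP_eq_near_zero L, eventually_notMem_lattice L] with w hw hw'
    have : L.derivWeierstrassP w = 0 := h0 hw'
    rw [← hw, this, zero_mul]
  have := tendsto_nhds_unique h1 h2
  norm_num at this

lemma hasDerivAt_weierstrassP {z : ℂ} (hz : z ∉ L.lattice) :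
    HasDerivAt L.weierstrassP (L.derivWeierstrassP z) z := by
  rw [← L.deriv_weierstrassP]
  exact (L.analyticOnNhd_weierstrassP z hz).differentiableAt.hasDerivAt

/-- The second-order differential equation `℘'' = 6℘² - g₂/2`. -/
lemma hasDerivAt_derivWeierstrassP {z : ℂ} (hz : z ∉ L.lattice) :
    HasDerivAt L.derivWeierstrassP (6 * L.weierstrassP z ^ 2 - L.g₂ / 2) z := by
  have hU : IsOpen (L.lattice : Set ℂ)ᶜ := L.isClosed_lattice.isOpen_compl
  have hd (w : ℂ) (hw : w ∉ L.lattice) : DifferentiableAt ℂ L.derivWeierstrassP w :=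
    (L.analyticOnNhd_derivWeierstrassP w hw).differentiableAt
  -- differentiate the first-order equation and cancel `℘'` where it is not zero
  have key : ∀ w ∉ L.lattice, L.derivWeierstrassP w ≠ 0 →
      deriv L.derivWeierstrassP w = 6 * L.weierstrassP w ^ 2 - L.g₂ / 2 := by
    intro w hw hne
    have h1 := (hd w hw).hasDerivAt.pow 2
    have hp := hasDerivAt_weierstrassP L hw
    have h2 := (((hp.pow 3).const_mul 4).sub (hp.const_mul L.g₂)).sub_const L.g₃
    have h3 := h1.unique (h2.congr_of_eventuallyEq (by
      filter_upwards [hU.mem_nhds hw] with x hx using L.derivWeierstrassP_sq x hx))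
    apply mul_left_cancel₀ hne
    norm_num at h3
    linear_combination h3 / 2
  have hlim : deriv L.derivWeierstrassP z = 6 * L.weierstrassP z ^ 2 - L.g₂ / 2 := by
    have c1 : ContinuousAt (deriv L.derivWeierstrassP) z :=
      (L.analyticOnNhd_derivWeierstrassP z hz).deriv.continuousAt
    have c2 : ContinuousAt (fun w ↦ 6 * L.weierstrassP w ^ 2 - L.g₂ / 2) z :=
      (((hasDerivAt_weierstrassP L hz).continuousAt.pow 2).const_mul 6).sub_const _
    refine tendsto_nhds_unique (c1.tendsto.mono_left nhdsWithin_le_nhds)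
      ((c2.tendsto.mono_left (nhdsWithin_le_nhds (s := {z}ᶜ))).congr' ?_)
    filter_upwards [derivWeierstrassP_eventually_ne_zero L hz,
      mem_nhdsWithin_of_mem_nhds (hU.mem_nhds hz)] with w hw hw' using (key w hw' hw).symm
  exact hlim ▸ (hd z hz).hasDerivAt

end Weierstrass

section NormalizedWeierstrass

variable {τ : ℍ} {z : ℂ}

lemma hasNDerivAt_wp (hz : z ∉ (periodPair τ).lattice) :
    HasNDerivAt (wp τ) (wpDeriv τ z) z := by
  refine HasDerivAt.congr_deriv ((hasDerivAt_weierstrassP _ hz).div_const _) ?_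
  have := two_pi_I_ne_zero
  rw [wpDeriv]
  field_simp

lemma hasNDerivAt_wpDeriv (hz : z ∉ (periodPair τ).lattice) :
    HasNDerivAt (wpDeriv τ) (6 * wp τ z ^ 2 - gTwo τ / 2) z := by
  refine HasDerivAt.congr_deriv ((hasDerivAt_derivWeierstrassP _ hz).div_const _) ?_
  have := two_pi_I_ne_zero
  rw [wp, gTwo]
  field_simp

lemma wpDeriv_sq (hz : z ∉ (periodPair τ).lattice) :
    wpDeriv τ z ^ 2 = 4 * wp τ z ^ 3 - gTwo τ * wp τ z - gThree τ := by
  have := two_pi_I_ne_zero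
  have h := (periodPair τ).derivWeierstrassP_sq z hz
  simp only [wpDeriv, wp, gTwo, gThree, div_pow, h]
  field_simp

/-- A polynomial that vanishes at all values of `wp` is zero. -/
lemma polynomial_eq_zero_of_eval_wp {τ : ℍ} {p : Polynomial ℂ}
    (h : ∀ z ∉ (periodPair τ).lattice, p.eval (wp τ z) = 0) : p = 0 := by
  have hlim : Tendsto (fun z ↦ ‖wp τ z‖) (𝓝[≠] 0) atTop := by
    have h1 := (periodPair τ).order_weierstrassP 0 (by simp)
    have h2 := tendsto_cobounded_of_meromorphicOrderAt_neg (x := (0 : ℂ))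
      (f := (periodPair τ).weierstrassP) (by rw [h1]; decide)
    have h3 := (tendsto_norm_cobounded_atTop.comp h2).atTop_div_const Real.two_pi_pos
      |>.atTop_div_const Real.two_pi_pos
    refine h3.congr fun z ↦ ?_
    rw [wp, norm_div, norm_pow, norm_two_pi_I, div_div, sq, Function.comp]
  by_contra hp
  have hfin : {w | p.IsRoot w}.Finite := p.finite_setOfPred_isRoot hp
  obtain ⟨r, hr⟩ := hfin.isBounded.exists_norm_le
  obtain ⟨z, hz, hzL⟩ := ((hlim.eventually_gt_atTop r).and (eventually_notMem_lattice _)).exists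
  exact absurd (hr _ (h z hzL)) (not_le.mpr hz)

end NormalizedWeierstrass

/-! ### Derivatives of the theta function in terms of the Weierstrass function -/

/-- The difference between `-∂_z² log ϑ` and `wp`. It equals `-E₂/12`; here it is read off from the
Taylor expansion of `ϑ` at the origin. -/
def thetaC (τ : ℍ) : ℂ := -thetaD 3 τ 0 / (3 * thetaD 1 τ 0)

lemma theta_derivs_add_one (τ : ℍ) (z : ℂ) :
    thetaD 1 τ (z + 1) = -thetaD 1 τ z ∧ thetaD 2 τ (z + 1) = -thetaD 2 τ z := by
  have shift (k : ℕ) (w : ℂ) :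
      HasNDerivAt (fun w ↦ thetaD k τ (w + 1)) (thetaD (k + 1) τ (w + 1)) w := by
    have := (hasNDerivAt_thetaD k τ (1 * w + 1)).comp_affine
    simpa using this
  have h1 (w : ℂ) : thetaD 1 τ (w + 1) = -thetaD 1 τ w :=
    (shift 0 w).unique ((hasNDerivAt_thetaD 0 τ w).neg.congr_of_eventuallyEq
      (.of_forall fun x ↦ theta_add_one τ x))
  exact ⟨h1 z, (shift 1 z).unique ((hasNDerivAt_thetaD 1 τ z).neg.congr_of_eventuallyEq
      (.of_forall fun x ↦ h1 x))⟩

/-- The automorphy factor of `ϑ` for `z ↦ z + τ`. -/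
def thetaMult (τ : ℍ) (z : ℂ) : ℂ := -cexp (-(2 * π * I * ((τ : ℂ) / 2 + z)))

lemma thetaMult_ne_zero (τ : ℍ) (z : ℂ) : thetaMult τ z ≠ 0 :=
  neg_ne_zero.mpr (Complex.exp_ne_zero _)

lemma hasNDerivAt_thetaMult (τ : ℍ) (z : ℂ) :
    HasNDerivAt (thetaMult τ) (-thetaMult τ z) z := by
  have := ((((hasDerivAt_id z).const_add ((τ : ℂ) / 2)).const_mul (2 * π * I)).neg).cexp.neg
  refine HasDerivAt.congr_deriv this ?_
  simp [thetaMult]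
  ring

lemma theta_derivs_add_tau (τ : ℍ) (z : ℂ) :
    thetaD 1 τ (z + τ) = thetaMult τ z * (thetaD 1 τ z - thetaD 0 τ z) ∧
      thetaD 2 τ (z + τ) =
        thetaMult τ z * (thetaD 2 τ z - 2 * thetaD 1 τ z + thetaD 0 τ z) := by
  have shift (k : ℕ) (w : ℂ) :
      HasNDerivAt (fun w ↦ thetaD k τ (w + τ)) (thetaD (k + 1) τ (w + τ)) w := by
    have := (hasNDerivAt_thetaD k τ (1 * w + τ)).comp_affine
    simpa using this
  have h1 (w : ℂ) : thetaD 1 τ (w + τ) = thetaMult τ w * (thetaD 1 τ w - thetaD 0 τ w) :=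
    ((shift 0 w).unique (((hasNDerivAt_thetaMult τ w).mul
      (hasNDerivAt_thetaD 0 τ w)).congr_of_eventuallyEq
        (.of_forall fun x ↦ theta_add_tau τ x))).trans (by ring)
  refine ⟨h1 z, ((shift 1 z).unique (((hasNDerivAt_thetaMult τ z).mul
      ((hasNDerivAt_thetaD 1 τ z).sub (hasNDerivAt_thetaD 0 τ z))).congr_of_eventuallyEq
        (.of_forall fun x ↦ h1 x))).trans ?_⟩
  ring

/-- `ϑ'² - ϑ ϑ''`, the numerator of `-∂_z² log ϑ`. -/
def thetaP (τ z : ℂ) : ℂ := thetaD 1 τ z ^ 2 - thetaD 0 τ z * thetaD 2 τ z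

lemma hasNDerivAt_thetaP (τ : ℍ) (z : ℂ) : HasNDerivAt (thetaP τ)
    (thetaD 1 τ z * thetaD 2 τ z - thetaD 0 τ z * thetaD 3 τ z) z := by
  refine (((hasNDerivAt_thetaD 1 τ z).pow 2).sub ((hasNDerivAt_thetaD 0 τ z).mul
    (hasNDerivAt_thetaD 2 τ z))).congr_deriv ?_
  norm_num
  ring

lemma differentiable_thetaP (τ : ℍ) : Differentiable ℂ (thetaP τ) :=
  fun z ↦ HasDerivAt.differentiableAt (hasNDerivAt_thetaP τ z)

lemma thetaP_add_one (τ : ℍ) (z : ℂ) : thetaP τ (z + 1) = thetaP τ z := by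
  simp only [thetaP, theta_derivs_add_one, theta_add_one]
  ring

lemma thetaP_add_tau (τ : ℍ) (z : ℂ) : thetaP τ (z + τ) = thetaMult τ z ^ 2 * thetaP τ z := by
  have h : thetaD 0 τ (z + τ) = thetaMult τ z * thetaD 0 τ z := theta_add_tau τ z
  simp only [thetaP, theta_derivs_add_tau, h]
  ring

lemma thetaP_zero (τ : ℂ) : thetaP τ 0 = thetaD 1 τ 0 ^ 2 := by
  simp [thetaP, thetaD_zero_zero τ (by decide : Even 0)]

/-- `-∂_z² log ϑ` differs from the Weierstrass function by a constant. -/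
lemma thetaP_eq {τ : ℍ} {z : ℂ} (hz : z ∉ (periodPair τ).lattice) :
    thetaP τ z = (wp τ z + thetaC τ) * thetaD 0 τ z ^ 2 := by
  have hpi := two_pi_I_ne_zero
  have hθ := differentiable_thetaD 0 τ.im_pos
  -- write `ϑ(z) = z s(z)` with `s` entire
  set s := dslope (thetaD 0 τ) 0 with hs
  have hsd : Differentiable ℂ s := differentiable_dslope hθ 0
  have hsd1 : Differentiable ℂ (deriv s) :=
    hsd.deriv
  have hsd2 : Differentiable ℂ (deriv (deriv s)) :=
    hsd1.deriv
  have h0 (w : ℂ) : thetaD 0 τ w = w * s w := by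
    have := sub_smul_dslope (thetaD 0 τ) 0 w
    rw [thetaD_zero_zero (τ : ℂ) (by decide : Even 0), sub_zero, sub_zero] at this
    exact this.symm
  have h1 (w : ℂ) : 2 * π * I * thetaD 1 τ w = s w + w * deriv s w := by
    refine (hasDerivAt_thetaD_z 0 τ.im_pos w).unique ?_
    rw [show thetaD 0 (τ : ℂ) = fun w ↦ w * s w from funext h0]
    exact ((hasDerivAt_id w).mul (hsd w).hasDerivAt).congr_deriv (by simp)
  have h2 (w : ℂ) : (2 * π * I) ^ 2 * thetaD 2 τ w = 2 * deriv s w + w * deriv (deriv s) w := by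
    have e1 := (hasDerivAt_thetaD_z 1 τ.im_pos w).const_mul (2 * π * I)
    rw [show (fun y ↦ 2 * π * I * thetaD 1 τ y) = fun w ↦ s w + w * deriv s w from funext h1] at e1
    have e2 := (hsd w).hasDerivAt.add ((hasDerivAt_id w).mul (hsd1 w).hasDerivAt)
    have := e1.unique e2
    simp only [id] at this
    linear_combination this
  have h3 : (2 * π * I) ^ 3 * thetaD 3 τ 0 = 3 * deriv (deriv s) 0 := by
    have e1 := (hasDerivAt_thetaD_z 2 τ.im_pos 0).const_mul ((2 * π * I) ^ 2)
    rw [show (fun y ↦ (2 * π * I) ^ 2 * thetaD 2 τ y) =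
      fun w ↦ 2 * deriv s w + w * deriv (deriv s) w from funext h2] at e1
    have e2 := ((hsd1 0).hasDerivAt.const_mul 2).add
      ((hasDerivAt_id 0).mul (hsd2 0).hasDerivAt)
    have := e1.unique e2
    simp only [id] at this
    linear_combination this
  have hs0 : s 0 = 2 * π * I * thetaD 1 τ 0 := by rw [h1]; ring
  have hs1 : deriv s 0 = 0 := by
    have := h2 0
    rw [thetaD_zero_zero (τ : ℂ) (by decide : Even 2)] at this
    linear_combination -this / 2
  have hA := thetaD_one_zero_ne_zero τ
  have hs0' : s 0 ≠ 0 := hs0 ▸ mul_ne_zero hpi hA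
  let g : ℂ → ℂ := fun w ↦ ((deriv s w ^ 2 - s w * deriv (deriv s) w) / s w ^ 2 -
    (periodPair τ).weierstrassPExcept 0 w) / (2 * π * I) ^ 2
  have hg : AnalyticAt ℂ g 0 := by
    have a0 := hsd.analyticAt 0
    have a1 := hsd1.analyticAt 0
    have a2 := hsd2.analyticAt 0
    have a3 := (periodPair τ).analyticAt_weierstrassPExcept 0
    have a4 : AnalyticAt ℂ (fun w ↦ (deriv s w ^ 2 - s w * deriv (deriv s) w) / s w ^ 2) 0 :=
      ((a1.pow 2).sub (a0.mul a2)).div (a0.pow 2) (pow_ne_zero 2 hs0')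
    exact (a4.sub a3).div_const
  have hg0 : g 0 = thetaC τ := by
    simp only [g, hs1, PeriodPair.weierstrassPExcept_zero, thetaC]
    have : deriv (deriv s) 0 = (2 * π * I) ^ 3 * thetaD 3 τ 0 / 3 := by rw [h3]; ring
    rw [this, hs0]
    field_simp
    ring
  have hUo : IsOpen ((periodPair τ).lattice : Set ℂ)ᶜ :=
      (periodPair τ).isClosed_lattice.isOpen_compl
  have hconst := eq_of_periodic_of_removable (L := periodPair τ)
    (h := fun w ↦ thetaP τ w / thetaD 0 τ w ^ 2 - wp τ w) (g := g) (z := z) ?_ ?_ ?_ hg ?_ hz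
  · rw [hg0, sub_eq_iff_eq_add, div_eq_iff (pow_ne_zero 2 (thetaD_zero_ne_zero hz))] at hconst
    rw [hconst]
    ring
  · refine ((differentiable_thetaP τ).differentiableOn.div (hθ.differentiableOn.pow 2)
      fun w hw ↦ pow_ne_zero 2 (thetaD_zero_ne_zero hw)).sub fun w hw ↦ ?_
    exact (HasDerivAt.differentiableAt (hasNDerivAt_wp hw)).differentiableWithinAt
  · intro w _
    have hw' : wp τ (w + τ) = wp τ w := by
      rw [wp, wp, ← (periodPair τ).weierstrassP_add_coe w ⟨_, (periodPair τ).ω₁_mem_lattice⟩]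
      rfl
    have h : thetaD 0 τ (w + τ) = thetaMult τ w * thetaD 0 τ w := theta_add_tau τ w
    change thetaP τ (w + τ) / thetaD 0 τ (w + τ) ^ 2 - wp τ (w + τ) = _
    rw [thetaP_add_tau, h, hw', mul_pow, mul_div_mul_left _ _
        (pow_ne_zero 2 (thetaMult_ne_zero τ w))]
  · intro w _
    have hw' : wp τ (w + 1) = wp τ w := by
      rw [wp, wp, ← (periodPair τ).weierstrassP_add_coe w ⟨_, (periodPair τ).ω₂_mem_lattice⟩]
      rfl
    change thetaP τ (w + 1) / thetaD 0 τ (w + 1) ^ 2 - wp τ (w + 1) = _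
    rw [thetaP_add_one, theta_add_one, hw', neg_sq]
  · have hs_ne : ∀ᶠ w in 𝓝[≠] (0 : ℂ), s w ≠ 0 :=
      (hsd.continuous.continuousAt.eventually_ne hs0').filter_mono nhdsWithin_le_nhds
    filter_upwards [self_mem_nhdsWithin, hs_ne] with w (hw : w ≠ 0) hsw
    have e1 : thetaD 1 τ w = (s w + w * deriv s w) / (2 * π * I) := by
      rw [← h1]; field_simp
    have e2 : thetaD 2 τ w = (2 * deriv s w + w * deriv (deriv s) w) / (2 * π * I) ^ 2 := by
      rw [← h2]; field_simp
    have e3 : (periodPair τ).weierstrassP w =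
        (periodPair τ).weierstrassPExcept 0 w + 1 / w ^ 2 := by
      have := (periodPair τ).weierstrassPExcept_add 0 w
      simp only [ZeroMemClass.coe_zero, sub_zero] at this
      rw [← this]
      simp
    simp only [g, thetaP, wp, h0, e1, e2, e3]
    field_simp
    ring

/-- The logarithmic derivative of `ϑ`. -/
def thetaL (τ z : ℂ) : ℂ := thetaD 1 τ z / thetaD 0 τ z

section OffLattice

variable {τ : ℍ} {z : ℂ}

lemma hasNDerivAt_thetaL (hz : z ∉ (periodPair τ).lattice) :
    HasNDerivAt (thetaL τ) (-(wp τ z + thetaC τ)) z := by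
  have h0 := thetaD_zero_ne_zero hz
  refine ((hasNDerivAt_thetaD 1 τ z).div (hasNDerivAt_thetaD 0 τ z) h0).congr_deriv ?_
  rw [div_eq_iff (pow_ne_zero 2 h0)]
  have := thetaP_eq hz
  rw [thetaP] at this
  linear_combination -this

lemma thetaD_succ_eq {k : ℕ} {r r' : ℂ → ℂ}
    (h : ∀ z ∉ (periodPair τ).lattice, thetaD k τ z = r z * thetaD 0 τ z)
    (hr : ∀ z ∉ (periodPair τ).lattice, HasNDerivAt r (r' z) z) :
    ∀ z ∉ (periodPair τ).lattice,
      thetaD (k + 1) τ z = (r' z + r z * thetaL τ z) * thetaD 0 τ z := by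
  intro z hz
  have hU : IsOpen ((periodPair τ).lattice : Set ℂ)ᶜ := (periodPair τ).isClosed_lattice.isOpen_compl
  have h1 := (hasNDerivAt_thetaD k τ z).unique (((hr z hz).mul
    (hasNDerivAt_thetaD 0 τ z)).congr_of_eventuallyEq (by
      filter_upwards [hU.mem_nhds hz] with w hw using h w hw))
  rw [h1, thetaL]
  have := thetaD_zero_ne_zero hz
  field_simp

/-- The derivatives of `ϑ` up to order five, divided by `ϑ`, as polynomials in the logarithmic
derivative of `ϑ`, the Weierstrass function and its derivative. -/
lemma thetaD_eq_mul (hz : z ∉ (periodPair τ).lattice) :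
    let l := thetaL τ z
    let p := wp τ z + thetaC τ
    let v := wpDeriv τ z
    let u := 6 * wp τ z ^ 2 - gTwo τ / 2
    thetaD 1 τ z = l * thetaD 0 τ z ∧
    thetaD 2 τ z = (l ^ 2 - p) * thetaD 0 τ z ∧
    thetaD 3 τ z = (l ^ 3 - 3 * l * p - v) * thetaD 0 τ z ∧
    thetaD 4 τ z = (l ^ 4 - 6 * l ^ 2 * p - 4 * l * v + 3 * p ^ 2 - u) * thetaD 0 τ z ∧
    thetaD 5 τ z = (l ^ 5 - 10 * l ^ 3 * p - 10 * l ^ 2 * v + 15 * l * p ^ 2 - 5 * l * u +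
      10 * p * v - 12 * wp τ z * v) * thetaD 0 τ z := by
  have hp (z : ℂ) (hz : z ∉ (periodPair τ).lattice) :
      HasNDerivAt (fun z ↦ wp τ z + thetaC τ) (wpDeriv τ z) z :=
    ((hasNDerivAt_wp hz).add (.const _ _)).congr_deriv (add_zero _)
  have hl (z : ℂ) (hz : z ∉ (periodPair τ).lattice) := hasNDerivAt_thetaL hz
  have hv (z : ℂ) (hz : z ∉ (periodPair τ).lattice) := hasNDerivAt_wpDeriv hz
  have hu (z : ℂ) (hz : z ∉ (periodPair τ).lattice) :
      HasNDerivAt (fun z ↦ 6 * wp τ z ^ 2 - gTwo τ / 2) (12 * wp τ z * wpDeriv τ z) z :=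
    (((((hasNDerivAt_wp hz).pow 2).const_mul 6).sub (.const _ _))).congr_deriv (by norm_num; ring)
  have h1 : ∀ z ∉ (periodPair τ).lattice, thetaD 1 τ z = thetaL τ z * thetaD 0 τ z :=
    fun z hz ↦ by rw [thetaL, div_mul_cancel₀ _ (thetaD_zero_ne_zero hz)]
  have h2 : ∀ z ∉ (periodPair τ).lattice, thetaD 2 τ z =
      (thetaL τ z ^ 2 - (wp τ z + thetaC τ)) * thetaD 0 τ z := fun z hz ↦ by
    rw [thetaD_succ_eq h1 hl z hz]; ring
  have h3 : ∀ z ∉ (periodPair τ).lattice, thetaD 3 τ z = (thetaL τ z ^ 3 -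
      3 * thetaL τ z * (wp τ z + thetaC τ) - wpDeriv τ z) * thetaD 0 τ z := fun z hz ↦ by
    rw [thetaD_succ_eq h2 (fun z hz ↦ ((hl z hz).pow 2).sub (hp z hz)) z hz]
    simp only [Nat.cast_ofNat, Nat.reduceSub, pow_one]
    ring
  have h4 : ∀ z ∉ (periodPair τ).lattice, thetaD 4 τ z = (thetaL τ z ^ 4 -
      6 * thetaL τ z ^ 2 * (wp τ z + thetaC τ) - 4 * thetaL τ z * wpDeriv τ z +
      3 * (wp τ z + thetaC τ) ^ 2 - (6 * wp τ z ^ 2 - gTwo τ / 2)) * thetaD 0 τ z := fun z hz ↦ by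
    rw [thetaD_succ_eq h3 (fun z hz ↦ (((hl z hz).pow 3).sub
      (((hl z hz).const_mul 3).mul (hp z hz))).sub (hv z hz)) z hz]
    simp only [Nat.cast_ofNat, Nat.reduceSub]
    ring
  refine ⟨h1 z hz, h2 z hz, h3 z hz, h4 z hz, ?_⟩
  rw [thetaD_succ_eq h4 (fun z hz ↦ (((((hl z hz).pow 4).sub
    ((((hl z hz).pow 2).const_mul 6).mul (hp z hz))).sub (((hl z hz).const_mul 4).mul
      (hv z hz))).add (((hp z hz).pow 2).const_mul 3)).sub (hu z hz)) z hz]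
  simp only [Nat.cast_ofNat, Nat.reduceSub]
  ring

end OffLattice

/-! ### Addition, duplication and triplication formulas -/

/-- An entire function with the automorphy factors of `ϑ²` and a double zero at the origin is a
multiple of `ϑ²`. -/
lemma exists_eq_mul_theta_sq {τ : ℍ} {N : ℂ → ℂ} (hN : Differentiable ℂ N) (h0 : N 0 = 0)
    (h0' : HasNDerivAt N 0 0) (h₁ : ∀ z, N (z + τ) = thetaMult τ z ^ 2 * N z)
    (h₂ : ∀ z, N (z + 1) = N z) :
    ∃ C, ∀ z ∉ (periodPair τ).lattice, N z = C * thetaD 0 τ z ^ 2 := by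
  have hθ := differentiable_thetaD 0 τ.im_pos
  have hN1 := differentiable_dslope hN 0
  have h0d : deriv N 0 = 0 := by simpa using HasDerivAt.deriv h0'
  have hθd : deriv (thetaD 0 τ) 0 ≠ 0 := by
    rw [(hasDerivAt_thetaD_z 0 τ.im_pos 0).deriv]
    exact mul_ne_zero two_pi_I_ne_zero (thetaD_one_zero_ne_zero τ)
  let g : ℂ → ℂ := fun z ↦ dslope (dslope N 0) 0 z / dslope (thetaD 0 τ) 0 z ^ 2
  have hg : AnalyticAt ℂ g 0 := by
    refine ((differentiable_dslope hN1 0).analyticAt 0).div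
      (((differentiable_dslope hθ 0).analyticAt 0).pow 2) (pow_ne_zero 2 ?_)
    rwa [dslope_same]
  refine ⟨g 0, fun z hz ↦ ?_⟩
  rw [← div_eq_iff (pow_ne_zero 2 (thetaD_zero_ne_zero hz))]
  refine eq_of_periodic_of_removable (L := periodPair τ)
    (h := fun w ↦ N w / thetaD 0 τ w ^ 2) ?_ ?_ ?_ hg ?_ hz
  · exact hN.differentiableOn.div (hθ.differentiableOn.pow 2)
      fun w hw ↦ pow_ne_zero 2 (thetaD_zero_ne_zero hw)
  · intro w _
    have h : thetaD 0 τ (w + τ) = thetaMult τ w * thetaD 0 τ w := theta_add_tau τ w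
    change N (w + τ) / thetaD 0 τ (w + τ) ^ 2 = _
    rw [h₁, h, mul_pow, mul_div_mul_left _ _ (pow_ne_zero 2 (thetaMult_ne_zero τ w))]
  · intro w _
    change N (w + 1) / thetaD 0 τ (w + 1) ^ 2 = _
    rw [h₂, theta_add_one, neg_sq]
  · filter_upwards [self_mem_nhdsWithin] with w (hw : w ≠ 0)
    simp only [g, dslope_of_ne _ hw, slope_def_field, dslope_same, h0, h0d, sub_zero,
      thetaD_zero_zero (τ : ℂ) (by decide : Even 0)]
    rw [div_pow, div_div (N w / w), div_div (N w), show w * (w * (thetaD 0 τ w ^ 2 / w ^ 2)) =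
      thetaD 0 τ w ^ 2 by field_simp]

/-- The addition formula `ϑ(x + y) ϑ(x - y) ϑ'(0)² = ϑ(x)² ϑ(y)² (wp(y) - wp(x))`. -/
lemma theta_add_mul_theta_sub {τ : ℍ} {y : ℂ} (hy : y ∉ (periodPair τ).lattice) (x : ℂ) :
    thetaD 0 τ (x + y) * thetaD 0 τ (x - y) * thetaD 1 τ 0 ^ 2 =
      thetaP τ y * thetaD 0 τ x ^ 2 - thetaP τ x * thetaD 0 τ y ^ 2 := by
  have hθ (k : ℕ) := differentiable_thetaD k τ.im_pos
  have hP := differentiable_thetaP τ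
  have hadd (z : ℂ) : HasNDerivAt (fun x ↦ thetaD 0 τ (x + y)) (thetaD 1 τ (z + y)) z := by
    simpa using (hasNDerivAt_thetaD 0 τ (1 * z + y)).comp_affine
  have hsub (z : ℂ) : HasNDerivAt (fun x ↦ thetaD 0 τ (x - y)) (thetaD 1 τ (z - y)) z := by
    simpa [← sub_eq_add_neg] using (hasNDerivAt_thetaD 0 τ (1 * z + -y)).comp_affine
  have hneg0 := thetaD_neg 0 τ y
  have hneg1 := thetaD_neg 1 τ y
  let N : ℂ → ℂ := fun x ↦ thetaD 0 τ (x + y) * thetaD 0 τ (x - y) * thetaD 1 τ 0 ^ 2 +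
    thetaP τ x * thetaD 0 τ y ^ 2
  have hNd (z : ℂ) := (((hadd z).mul (hsub z)).mul (.const (thetaD 1 τ 0 ^ 2) z)).add
    ((hasNDerivAt_thetaP τ z).mul (.const (thetaD 0 τ y ^ 2) z))
  have hN : Differentiable ℂ N := fun z ↦ HasDerivAt.differentiableAt (hNd z)
  have hex : ∃ C, ∀ z ∉ (periodPair τ).lattice, N z = C * thetaD 0 τ z ^ 2 := by
    refine exists_eq_mul_theta_sq hN ?_ ?_ ?_ ?_
    · simp only [N, zero_add, zero_sub, hneg0, thetaP_zero]
      ring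
    · refine (hNd 0).congr_deriv ?_
      simp only [zero_add, zero_sub, hneg0, hneg1, thetaD_zero_zero (τ : ℂ) (by decide : Even 0),
        thetaD_zero_zero (τ : ℂ) (by decide : Even 2)]
      ring
    · intro z
      have e1 : thetaD 0 τ (z + τ + y) = thetaMult τ (z + y) * thetaD 0 τ (z + y) := by
        rw [add_right_comm]; exact theta_add_tau τ _
      have e2 : thetaD 0 τ (z + τ - y) = thetaMult τ (z - y) * thetaD 0 τ (z - y) := by
        rw [add_sub_right_comm]; exact theta_add_tau τ _
      have e3 : thetaMult τ (z + y) * thetaMult τ (z - y) = thetaMult τ z ^ 2 := by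
        simp only [thetaMult, neg_mul_neg, sq, ← Complex.exp_add]
        ring_nf
      simp only [N, e1, e2, thetaP_add_tau]
      linear_combination (thetaD 0 τ (z + y) * thetaD 0 τ (z - y) * thetaD 1 τ 0 ^ 2) * e3
    · intro z
      simp only [N, thetaP_add_one, add_right_comm z 1 y, add_sub_right_comm z 1 y, theta_add_one]
      ring
  obtain ⟨C, hC⟩ := hex
  have hCy := hC y hy
  have h0 := thetaD_zero_ne_zero hy
  simp only [N, sub_self, thetaD_zero_zero (τ : ℂ) (by decide : Even 0), mul_zero, zero_mul,
    zero_add] at hCy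
  have hCv : C = thetaP τ y := mul_right_cancel₀ (pow_ne_zero 2 h0) hCy.symm
  have hall : N x = C * thetaD 0 τ x ^ 2 := eq_of_eqOn_compl_lattice (L := periodPair τ)
    hN.continuous (((hθ 0).continuous.pow 2).const_mul C) hC x
  rw [← hCv]
  simp only [N] at hall
  linear_combination hall

/-- `2 ϑ'³ - 3 ϑ ϑ' ϑ'' + ϑ² ϑ'''`, the numerator of `∂_z³ log ϑ`. -/
def thetaB (τ z : ℂ) : ℂ :=
  2 * thetaD 1 τ z ^ 3 - 3 * thetaD 0 τ z * thetaD 1 τ z * thetaD 2 τ z +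
    thetaD 0 τ z ^ 2 * thetaD 3 τ z

section Multiplication

variable {τ : ℍ} {z : ℂ}

/-- The duplication formula, obtained from the addition formula by differentiating at `x = y`. -/
lemma theta_two_mul (hz : z ∉ (periodPair τ).lattice) :
    thetaD 0 τ (2 * z) * thetaD 1 τ 0 ^ 3 = thetaD 0 τ z * thetaB τ z := by
  have hadd : HasNDerivAt (fun x ↦ thetaD 0 τ (x + z)) (thetaD 1 τ (z + z)) z := by
    simpa using (hasNDerivAt_thetaD 0 τ (1 * z + z)).comp_affine
  have hsub : HasNDerivAt (fun x ↦ thetaD 0 τ (x - z)) (thetaD 1 τ (z - z)) z := by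
    simpa [← sub_eq_add_neg] using (hasNDerivAt_thetaD 0 τ (1 * z + -z)).comp_affine
  have h1 := (hadd.mul hsub).mul (.const (thetaD 1 τ 0 ^ 2) z)
  have h2 := (((hasNDerivAt_thetaD 0 τ z).pow 2).const_mul (thetaP τ z)).sub
    ((hasNDerivAt_thetaP τ z).mul (.const (thetaD 0 τ z ^ 2) z))
  have h := h1.unique (h2.congr_of_eventuallyEq (.of_forall (theta_add_mul_theta_sub hz)))
  simp only [sub_self, thetaD_zero_zero (τ : ℂ) (by decide : Even 0), ← two_mul,
    Nat.cast_ofNat, Nat.reduceSub] at h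
  rw [thetaP] at h
  rw [thetaB]
  linear_combination h

lemma thetaB_eq (hz : z ∉ (periodPair τ).lattice) :
    thetaB τ z = -wpDeriv τ z * thetaD 0 τ z ^ 3 := by
  obtain ⟨h1, h2, h3, -, -⟩ := thetaD_eq_mul hz
  rw [thetaB, h1, h2, h3]
  ring

lemma theta_two_mul' (hz : z ∉ (periodPair τ).lattice) :
    thetaD 0 τ (2 * z) * thetaD 1 τ 0 ^ 3 = -wpDeriv τ z * thetaD 0 τ z ^ 4 := by
  rw [theta_two_mul hz, thetaB_eq hz]
  ring

/-- The triplication formula. It follows from the addition formula at `x = 2y` once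
`∂_z² log ϑ` at `2y` is computed from the duplication formula. -/
lemma theta_three_mul (hz : z ∉ (periodPair τ).lattice) :
    4 * thetaD 0 τ (3 * z) * thetaD 1 τ 0 ^ 8 =
      (12 * wp τ z * wpDeriv τ z ^ 2 - (6 * wp τ z ^ 2 - gTwo τ / 2) ^ 2) * thetaD 0 τ z ^ 9 := by
  have hU : IsOpen ((periodPair τ).lattice : Set ℂ)ᶜ := (periodPair τ).isClosed_lattice.isOpen_compl
  set A := thetaD 1 τ 0
  have hdouble (k : ℕ) (w : ℂ) : HasNDerivAt (fun w ↦ thetaD k τ (2 * w) * A ^ 3)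
      (2 * thetaD (k + 1) τ (2 * w) * A ^ 3) w := by
    have : HasNDerivAt (fun w ↦ thetaD k τ (2 * w)) (2 * thetaD (k + 1) τ (2 * w)) w := by
      simpa using (hasNDerivAt_thetaD k τ (2 * w + 0)).comp_affine
    exact (this.mul (.const _ _)).congr_deriv (by ring)
  have step {k : ℕ} {r r' : ℂ → ℂ}
      (h : ∀ w ∉ (periodPair τ).lattice, thetaD k τ (2 * w) * A ^ 3 = r w * thetaD 0 τ w ^ 4)
      (hr : ∀ w ∉ (periodPair τ).lattice, HasNDerivAt r (r' w) w) :
      ∀ w ∉ (periodPair τ).lattice, 2 * thetaD (k + 1) τ (2 * w) * A ^ 3 =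
        (r' w + 4 * thetaL τ w * r w) * thetaD 0 τ w ^ 4 := by
    intro w hw
    rw [(hdouble k w).unique (((hr w hw).mul
        ((hasNDerivAt_thetaD 0 τ w).pow 4)).congr_of_eventuallyEq
      (by filter_upwards [hU.mem_nhds hw] with x hx using h x hx)), zero_add,
      (thetaD_eq_mul hw).1]
    simp only [Nat.cast_ofNat, Nat.reduceSub]
    ring
  have h0 := fun w hw ↦ theta_two_mul' (τ := τ) (z := w) hw
  have h1 := step h0 (fun w hw ↦ (hasNDerivAt_wpDeriv hw).neg)
  have h2 := step (k := 1)
    (r := fun w ↦ (-(6 * wp τ w ^ 2 - gTwo τ / 2) + 4 * thetaL τ w * -wpDeriv τ w) * (1 / 2))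
    (fun w hw ↦ by linear_combination (1 / 2) * h1 w hw)
    (fun w hw ↦ ((((((hasNDerivAt_wp hw).pow 2).const_mul 6).sub (.const _ _)).neg).add
      (((hasNDerivAt_thetaL hw).const_mul 4).mul (hasNDerivAt_wpDeriv hw).neg)).mul (.const _ _))
  have e0 := h0 z hz
  have e1 := h1 z hz
  have e2 := h2 z hz
  have hadd := theta_add_mul_theta_sub hz (2 * z)
  rw [show 2 * z + z = 3 * z by ring, show 2 * z - z = z by ring, thetaP_eq hz, thetaP] at hadd
  have hne := thetaD_zero_ne_zero hz
  apply mul_right_cancel₀ hne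
  simp only [Nat.cast_ofNat, Nat.reduceSub, zero_add, Nat.reduceAdd] at e1 e2
  generalize thetaD 0 τ (2 * z) = d0 at *
  generalize thetaD 1 τ (2 * z) = d1 at *
  generalize thetaD 2 τ (2 * z) = d2 at *
  generalize thetaL τ z = l at *
  generalize thetaD 0 τ z = t at *
  generalize thetaD 0 τ (3 * z) = t3 at *
  generalize wp τ z = p at *
  generalize wpDeriv τ z = v at *
  change t3 * t * A ^ 2 = _ at hadd
  have f0 : 4 * (d1 ^ 2 - d0 * d2) * A ^ 6 =
      (2 * d1 * A ^ 3) ^ 2 - (d0 * A ^ 3) * (2 * (2 * d2 * A ^ 3)) := by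
    ring
  rw [e0, e1, e2] at f0
  have f1 : 4 * d0 ^ 2 * A ^ 6 = 4 * (d0 * A ^ 3) ^ 2 := by ring
  rw [e0] at f1
  linear_combination (4 * A ^ 6) * hadd + (p + thetaC τ) * t ^ 2 * f1 - t ^ 2 * f0

end Multiplication

/-! ### The Jacobi forms as polynomials in two basic forms -/

/-- `ϑ(z)² / ϑ'(0)²`, of weight `-2` and index `1`. -/
def jacX (τ : ℍ) (z : ℂ) : ℂ := thetaD 0 τ z ^ 2 / thetaD 1 τ 0 ^ 2

/-- The entire function `wp · jacX`, of weight `0` and index `1`. -/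
def jacY (τ : ℍ) (z : ℂ) : ℂ := thetaP τ z / thetaD 1 τ 0 ^ 2 - thetaC τ * jacX τ z

lemma jacY_eq {τ : ℍ} {z : ℂ} (hz : z ∉ (periodPair τ).lattice) :
    jacY τ z = wp τ z * jacX τ z := by
  rw [jacY, jacX, thetaP_eq hz]
  ring

lemma continuous_thetaD (k : ℕ) (τ : ℍ) : Continuous (thetaD k τ) :=
  (differentiable_thetaD k τ.im_pos).continuous

lemma continuous_jacX (τ : ℍ) : Continuous (jacX τ) := by
  have := continuous_thetaD 0 τ
  unfold jacX
  fun_prop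

lemma continuous_jacY (τ : ℍ) : Continuous (jacY τ) := by
  have := (differentiable_thetaP τ).continuous
  have := continuous_jacX τ
  unfold jacY
  fun_prop

lemma thetaQuotient_eq {N : ℕ} {τ : ℍ} {F : ℂ → ℂ} (hF : Continuous F)
    (h : ∀ z ∉ (periodPair τ).lattice, thetaD 0 τ (N * z) = F z * thetaD 0 τ z) (z : ℂ) :
    thetaQuotient N τ z = F z := by
  refine Tendsto.limUnder_eq ((hF.tendsto z).mono_left nhdsWithin_le_nhds |>.congr' ?_)
  rw [EventuallyEq, eventually_nhdsWithin_iff]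
  filter_upwards [(periodPair τ).compl_lattice_sdiff_singleton_mem_nhds z] with w hw hwz
  have hwz' : w ≠ z := hwz
  have hw' : w ∉ (periodPair τ).lattice := by simpa [hwz'] using hw
  rw [theta_eq_thetaD, theta_eq_thetaD, h w hw', mul_div_cancel_right₀ _ (thetaD_zero_ne_zero hw')]

lemma phiZeroThreeHalves_eq (τ : ℍ) (z : ℂ) :
    phiZeroThreeHalves τ z = thetaB τ z / thetaD 1 τ 0 ^ 3 := by
  have hA := thetaD_one_zero_ne_zero τ
  refine thetaQuotient_eq (F := fun z ↦ thetaB τ z / thetaD 1 τ 0 ^ 3) ?_ (fun w hw ↦ ?_) z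
  · have h0 := continuous_thetaD 0 τ
    have h1 := continuous_thetaD 1 τ
    have h2 := continuous_thetaD 2 τ
    have h3 := continuous_thetaD 3 τ
    unfold thetaB
    fun_prop
  · rw [Nat.cast_ofNat, div_mul_eq_mul_div, eq_div_iff (pow_ne_zero 3 hA), theta_two_mul hw]
    ring

/-- `φ_{0,3} = (4 wp³ - g₂ wp - g₃) jacX³`. -/
lemma phiZeroThree_eq (τ : ℍ) (z : ℂ) : phiZeroThree τ z =
    4 * jacY τ z ^ 3 - gTwo τ * jacX τ z ^ 2 * jacY τ z - gThree τ * jacX τ z ^ 3 := by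
  have hX := continuous_jacX τ
  have hY := continuous_jacY τ
  have h0 := continuous_thetaD 0 τ
  have h1 := continuous_thetaD 1 τ
  have h2 := continuous_thetaD 2 τ
  have h3 := continuous_thetaD 3 τ
  refine eq_of_eqOn_compl_lattice (L := periodPair τ) (f := phiZeroThree τ)
    (g := fun z ↦ 4 * jacY τ z ^ 3 - gTwo τ * jacX τ z ^ 2 * jacY τ z - gThree τ * jacX τ z ^ 3)
    ?_ (by fun_prop) (fun w hw ↦ ?_) z
  · have : phiZeroThree τ = fun z ↦ (thetaB τ z / thetaD 1 τ 0 ^ 3) ^ 2 :=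
      funext fun z ↦ by rw [phiZeroThree, phiZeroThreeHalves_eq]
    rw [this]
    unfold thetaB
    fun_prop
  · rw [phiZeroThree, phiZeroThreeHalves_eq, thetaB_eq hw, jacY_eq hw, jacX, div_pow, mul_pow,
      neg_sq, wpDeriv_sq hw]
    ring

/-- `φ_{0,4} = (3 wp⁴ - (3/2) g₂ wp² - 3 g₃ wp - g₂²/16) jacX⁴`. -/
lemma phiZeroFour_eq (τ : ℍ) (z : ℂ) : phiZeroFour τ z =
    3 * jacY τ z ^ 4 - 3 / 2 * gTwo τ * jacX τ z ^ 2 * jacY τ z ^ 2 -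
      3 * gThree τ * jacX τ z ^ 3 * jacY τ z - gTwo τ ^ 2 / 16 * jacX τ z ^ 4 := by
  have hX := continuous_jacX τ
  have hY := continuous_jacY τ
  have hA := thetaD_one_zero_ne_zero τ
  refine thetaQuotient_eq (F := fun z ↦ 3 * jacY τ z ^ 4 -
    3 / 2 * gTwo τ * jacX τ z ^ 2 * jacY τ z ^ 2 - 3 * gThree τ * jacX τ z ^ 3 * jacY τ z -
      gTwo τ ^ 2 / 16 * jacX τ z ^ 4) (by fun_prop) (fun w hw ↦ ?_) z
  have h3 := theta_three_mul hw
  rw [wpDeriv_sq hw] at h3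
  simp only [jacY_eq hw, jacX]
  rw [Nat.cast_ofNat]
  apply mul_right_cancel₀ (pow_ne_zero 8 hA)
  field_simp
  linear_combination 8 * h3

/-! ### The lattice invariants as Eisenstein series -/

lemma periodPair_G (τ : ℍ) {k : ℕ} (hk : 3 ≤ k) :
    (periodPair τ).G k = 2 * riemannZeta k * ModularForm.E hk τ := by
  have h1 : (periodPair τ).G k = ∑' v : Fin 2 → ℤ, EisensteinSeries.eisSummand k v τ := by
    rw [PeriodPair.G, ← (periodPair τ).latticeEquivProd.toEquiv.symm.tsum_eq,
      ← (finTwoArrowEquiv ℤ).tsum_eq]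
    refine tsum_congr fun v ↦ ?_
    have := (periodPair τ).latticeEquiv_symm_apply (v 0, v 1)
    simp only [finTwoArrowEquiv_apply, EisensteinSeries.eisSummand, zpow_neg, zpow_natCast]
    congr 2
    refine this.trans ?_
    simp [periodPair]
  rw [h1, tsum_eisSummand_eq_riemannZeta_mul_eisensteinSeries hk,
    show ModularForm.E hk τ = (1 / 2 : ℂ) • EisensteinSeries.eisensteinSeriesSIF (N := 1) 0 k τ
        from rfl,
    EisensteinSeries.eisensteinSeriesSIF_apply]
  simp
  ring

lemma gTwo_eq (τ : ℍ) : gTwo τ = E4 τ / 12 := by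
  have hpi : (π : ℂ) ≠ 0 := ofReal_ne_zero.mpr Real.pi_ne_zero
  have h := periodPair_G τ (k := 4) (by norm_num)
  rw [gTwo, PeriodPair.g₂, h, E4]
  push_cast
  rw [riemannZeta_four, mul_pow, mul_pow, I_pow_four]
  field_simp
  ring

lemma gThree_eq (τ : ℍ) : gThree τ = -E6 τ / 216 := by
  have hpi : (π : ℂ) ≠ 0 := ofReal_ne_zero.mpr Real.pi_ne_zero
  have h := periodPair_G τ (k := 6) (by norm_num)
  have hz : riemannZeta 6 = π ^ 6 / 945 := by
    have := riemannZeta_two_mul_nat (k := 3) (by norm_num)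
    norm_num [show bernoulli 6 = 1 / 42 by decide +kernel, Nat.factorial] at this
    rw [this]
    ring
  rw [gThree, PeriodPair.g₃, h, E6]
  push_cast
  rw [hz, mul_pow, mul_pow, show I ^ 6 = I ^ 4 * I ^ 2 by ring, I_pow_four, I_sq]
  field_simp
  ring

lemma E8_eq (τ : ℍ) : E8 τ = E4 τ ^ 2 := by
  let f : ModularForm 𝒮ℒ ((8 : ℕ) : ℤ) := ModularForm.E (k := 8) (by norm_num) -
    ModularForm.mcast (by norm_num) ((ModularForm.E (k := 4) (by norm_num)).pow 2)
  -- a form of weight `8` whose constant term vanishes is zero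
  have hf : f = 0 := by
    refine ModularForm.sturm_bound_levelOne_nat ?_
    have h0 : (qExpansion 1 f).coeff 0 = 0 := by
      simp [f, ModularForm.coe_mcast, PowerSeries.coeff_mul, sq,
        ModularForm.qExpansion_sub one_pos one_mem_strictPeriods_SL,
        ModularForm.qExpansion_pow one_pos one_mem_strictPeriods_SL,
        -PowerSeries.coeff_zero_eq_constantCoeff,
        EisensteinSeries.E_qExpansion_coeff_zero _ (show Even 8 by decide),
        EisensteinSeries.E_qExpansion_coeff_zero _ (show Even 4 by decide)]
    refine lt_of_lt_of_le ?_ (PowerSeries.nat_le_order (qExpansion 1 f) 1 fun i hi ↦ ?_)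
    · norm_num
    · obtain rfl : i = 0 := by lia
      exact h0
  have h : E8 τ - ((ModularForm.E (k := 4) (by norm_num)).pow 2) τ = 0 := congr($hf τ)
  rw [ModularForm.coe_pow, Pi.pow_apply] at h
  exact sub_eq_zero.mp h

/-! ### Derivatives in the modular variable -/

/-- `F : ℍ → ℂ` has derivative `F'` at `τ` with respect to `(2πi)⁻¹ d/dτ`. -/
def HasTauDeriv (F : ℍ → ℂ) (F' : ℂ) (τ : ℍ) : Prop := HasNDerivAt (F ∘ ofComplex) F' τ

namespace HasTauDeriv

variable {F G : ℍ → ℂ} {F' G' : ℂ} {τ : ℍ}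

lemma congr_deriv (h : HasTauDeriv F F' τ) (h' : F' = G') : HasTauDeriv F G' τ := h' ▸ h

lemma unique (h : HasTauDeriv F F' τ) (h' : HasTauDeriv F G' τ) : F' = G' :=
  HasNDerivAt.unique h h'

lemma congr_fun (h : HasTauDeriv F F' τ) (h' : ∀ τ, G τ = F τ) : HasTauDeriv G F' τ := by
  rwa [funext h']

lemma neg (hF : HasTauDeriv F F' τ) : HasTauDeriv (fun τ ↦ -F τ) (-F') τ := HasNDerivAt.neg hF

lemma const (c : ℂ) (τ : ℍ) : HasTauDeriv (fun _ ↦ c) 0 τ := HasNDerivAt.const c τ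

lemma add (hF : HasTauDeriv F F' τ) (hG : HasTauDeriv G G' τ) :
    HasTauDeriv (fun τ ↦ F τ + G τ) (F' + G') τ := HasNDerivAt.add hF hG

lemma sub (hF : HasTauDeriv F F' τ) (hG : HasTauDeriv G G' τ) :
    HasTauDeriv (fun τ ↦ F τ - G τ) (F' - G') τ := HasNDerivAt.sub hF hG

lemma mul (hF : HasTauDeriv F F' τ) (hG : HasTauDeriv G G' τ) :
    HasTauDeriv (fun τ ↦ F τ * G τ) (F' * G τ + F τ * G') τ :=
  (HasNDerivAt.mul hF hG).congr_deriv (by simp)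

lemma const_mul (c : ℂ) (hF : HasTauDeriv F F' τ) : HasTauDeriv (fun τ ↦ c * F τ) (c * F') τ :=
  HasNDerivAt.const_mul c hF

lemma div (hF : HasTauDeriv F F' τ) (hG : HasTauDeriv G G' τ) (h : G τ ≠ 0) :
    HasTauDeriv (fun τ ↦ F τ / G τ) ((F' * G τ - F τ * G') / G τ ^ 2) τ :=
  (HasNDerivAt.div hF hG (by simpa using h)).congr_deriv (by simp)

lemma pow (hF : HasTauDeriv F F' τ) (n : ℕ) :
    HasTauDeriv (fun τ ↦ F τ ^ n) (n * F τ ^ (n - 1) * F') τ :=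
  (HasNDerivAt.pow hF n).congr_deriv (by simp)

lemma normalizedDeriv_eq (hF : HasTauDeriv F F' τ) :
    Derivative.normalizedDerivOfComplex F τ = F' := by
  rw [Derivative.normalizedDerivOfComplex, HasDerivAt.deriv hF]
  exact inv_mul_cancel_left₀ two_pi_I_ne_zero F'

lemma of_hasDerivAt {f : ℂ → ℂ} (h : HasDerivAt f (2 * π * I * F') τ)
    (hf : ∀ τ : ℍ, F τ = f τ) : HasTauDeriv F F' τ := by
  refine HasDerivAt.congr_of_eventuallyEq h ?_
  filter_upwards [isOpen_upperHalfPlaneSet.mem_nhds τ.im_pos] with w hw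
  rw [Function.comp_apply, hf, ofComplex_apply_of_im_pos hw]

end HasTauDeriv

/-- The heat equation for `ϑ` and its derivatives. -/
lemma hasTauDeriv_thetaD (k : ℕ) (τ : ℍ) (z : ℂ) :
    HasTauDeriv (fun τ ↦ thetaD k τ z) (1 / 2 * thetaD (k + 2) τ z) τ :=
  .of_hasDerivAt (hasDerivAt_thetaD_tau k τ.im_pos z) fun _ ↦ rfl

lemma exists_hasTauDeriv {k : ℤ} (f : ModularForm 𝒮ℒ k) (τ : ℍ) : ∃ f', HasTauDeriv f f' τ := by
  have h := (UpperHalfPlane.mdifferentiableAt_iff.mp (f.holo' τ)).hasDerivAt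
  refine ⟨(2 * π * I)⁻¹ * deriv (f ∘ ofComplex) τ, ?_⟩
  have := two_pi_I_ne_zero
  refine HasDerivAt.congr_deriv h ?_
  rw [mul_inv_cancel_left₀ this]
  rfl

/-! ### Ramanujan's identities -/

lemma cubic_coeff_eq_zero {τ : ℍ} {a b c d : ℂ} (h : ∀ z ∉ (periodPair τ).lattice,
    a + b * wp τ z + c * wp τ z ^ 2 + d * wp τ z ^ 3 = 0) : a = 0 ∧ b = 0 ∧ c = 0 ∧ d = 0 := by
  have hpoly := polynomial_eq_zero_of_eval_wp (τ := τ) (p := (Cubic.mk d c b a).toPoly)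
    (fun z hz ↦ by rw [← h z hz]; simp [Cubic.toPoly]; ring)
  have := Cubic.toPoly_eq_zero_iff _ |>.mp hpoly
  simp only [Cubic.ext_iff] at this
  exact ⟨this.2.2.2, this.2.2.1, this.2.1, this.1⟩

lemma exists_hasTauDeriv_thetaC (τ : ℍ) : ∃ c', HasTauDeriv thetaC c' τ :=
  ⟨_, (hasTauDeriv_thetaD 3 τ 0).neg.div ((hasTauDeriv_thetaD 1 τ 0).const_mul 3)
    (mul_ne_zero three_ne_zero (thetaD_one_zero_ne_zero τ))⟩

lemma exists_hasTauDeriv_gTwo (τ : ℍ) : ∃ g', HasTauDeriv gTwo g' τ := by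
  obtain ⟨e, he⟩ := exists_hasTauDeriv (ModularForm.E (k := 4) (by norm_num)) τ
  refine ⟨_, (he.const_mul (1 / 12)).congr_fun fun τ ↦ ?_⟩
  rw [gTwo_eq, E4]
  ring

lemma exists_hasTauDeriv_gThree (τ : ℍ) : ∃ g', HasTauDeriv gThree g' τ := by
  obtain ⟨e, he⟩ := exists_hasTauDeriv (ModularForm.E (k := 6) (by norm_num)) τ
  refine ⟨_, (he.const_mul (-1 / 216)).congr_fun fun τ ↦ ?_⟩
  rw [gThree_eq, E6]
  ring

/-- The Weierstrass equation in terms of the theta function. -/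
lemma thetaB_sq (τ : ℍ) (z : ℂ) : thetaB τ z ^ 2 =
    4 * (thetaP τ z - thetaC τ * thetaD 0 τ z ^ 2) ^ 3 -
      gTwo τ * (thetaP τ z - thetaC τ * thetaD 0 τ z ^ 2) * thetaD 0 τ z ^ 4 -
      gThree τ * thetaD 0 τ z ^ 6 := by
  have h := phiZeroThree_eq τ z
  have hA := thetaD_one_zero_ne_zero τ
  rw [phiZeroThree, phiZeroThreeHalves_eq, jacY, jacX] at h
  field_simp at h
  linear_combination h

/-- The derivatives of `thetaC`, `g₂` and `g₃`. The heat equation turns the derivative in `τ` of the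
Weierstrass equation `wp'² = 4 wp³ - g₂ wp - g₃` into a polynomial equation for `wp` alone, whose
coefficients must therefore vanish. -/
lemma ramanujan (τ : ℍ) :
    HasTauDeriv thetaC (gTwo τ / 12 - thetaC τ ^ 2) τ ∧
    HasTauDeriv gTwo (6 * gThree τ - 4 * thetaC τ * gTwo τ) τ ∧
    HasTauDeriv gThree (gTwo τ ^ 2 / 3 - 6 * thetaC τ * gThree τ) τ := by
  obtain ⟨c', hc⟩ := exists_hasTauDeriv_thetaC τ
  obtain ⟨a', ha⟩ := exists_hasTauDeriv_gTwo τ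
  obtain ⟨b', hb⟩ := exists_hasTauDeriv_gThree τ
  have key : ∀ z ∉ (periodPair τ).lattice,
      (b' + 6 * thetaC τ * gThree τ - gTwo τ * (c' + thetaC τ ^ 2 + gTwo τ / 4)) +
        (a' + 4 * thetaC τ * gTwo τ - 6 * gThree τ) * wp τ z +
        (12 * c' + 12 * thetaC τ ^ 2 - gTwo τ) * wp τ z ^ 2 + 0 * wp τ z ^ 3 = 0 := by
    intro z hz
    have t (k : ℕ) := hasTauDeriv_thetaD k τ z
    have hP : HasTauDeriv (fun τ ↦ thetaP τ z) (thetaD 1 τ z * thetaD 3 τ z -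
        1 / 2 * thetaD 2 τ z ^ 2 - 1 / 2 * thetaD 0 τ z * thetaD 4 τ z) τ :=
      (((t 1).pow 2).sub ((t 0).mul (t 2))).congr_deriv (by
        simp only [Nat.cast_ofNat, Nat.reduceSub, Nat.reduceAdd]; ring)
    have hB : HasTauDeriv (fun τ ↦ thetaB τ z) (3 * thetaD 1 τ z ^ 2 * thetaD 3 τ z -
        3 / 2 * (thetaD 2 τ z ^ 2 * thetaD 1 τ z + thetaD 0 τ z * thetaD 3 τ z * thetaD 2 τ z +
          thetaD 0 τ z * thetaD 1 τ z * thetaD 4 τ z) +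
        thetaD 0 τ z * thetaD 2 τ z * thetaD 3 τ z + 1 / 2 * thetaD 0 τ z ^ 2 * thetaD 5 τ z) τ :=
      (((((t 1).pow 3).const_mul 2).sub ((((t 0).const_mul 3).mul (t 1)).mul (t 2))).add
        (((t 0).pow 2).mul (t 3))).congr_deriv (by
          simp only [Nat.cast_ofNat, Nat.reduceSub, Nat.reduceAdd]; ring)
    have hN := hP.sub (hc.mul ((t 0).pow 2))
    have h := (hB.pow 2).unique
      ((((((hN.pow 3).const_mul 4).sub ((ha.mul hN).mul ((t 0).pow 4))).sub
        (hb.mul ((t 0).pow 6)))).congr_fun fun τ ↦ thetaB_sq τ z)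
    obtain ⟨h1, h2, h3, h4, h5⟩ := thetaD_eq_mul hz
    have hv := wpDeriv_sq hz
    have h0 := thetaD_zero_ne_zero hz
    rw [thetaB_eq hz, thetaP_eq hz] at h
    simp only [Nat.cast_ofNat, Nat.reduceSub, Nat.reduceAdd, h1, h2, h3, h4, h5] at h
    apply mul_right_cancel₀ (pow_ne_zero 6 h0)
    linear_combination h - (3 * wp τ z - 9 * thetaC τ + 3 * thetaL τ z ^ 2) * thetaD 0 τ z ^ 6 * hv
  obtain ⟨k0, k1, k2, -⟩ := cubic_coeff_eq_zero key
  refine ⟨hc.congr_deriv ?_, ha.congr_deriv ?_, hb.congr_deriv ?_⟩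
  · linear_combination k2 / 12
  · linear_combination k1
  · linear_combination k0 + gTwo τ / 12 * k2

/-- Up to the factor `-12`, `thetaC` is the logarithmic derivative of `Δ = η²⁴`. -/
lemma thetaC_eq (τ : ℍ) : thetaC τ = -E2 τ / 12 := by
  obtain ⟨-, h2, h3⟩ := ramanujan τ
  have hΔ (τ : ℍ) : ModularForm.discriminant τ = gTwo τ ^ 3 - 27 * gThree τ ^ 2 := by
    rw [ModularForm.discriminant_eq_E₄_cube_sub_E₆_sq, gTwo_eq, gThree_eq, E4, E6]
    ring
  have hd1 : HasTauDeriv ModularForm.discriminant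
      (-12 * thetaC τ * ModularForm.discriminant τ) τ := by
    refine (((h2.pow 3).sub ((h3.pow 2).const_mul 27)).congr_fun hΔ).congr_deriv ?_
    rw [hΔ]
    simp only [Nat.cast_ofNat, Nat.reduceSub]
    ring
  have hη := ModularForm.eta_ne_zero τ.im_pos
  have hd2 : HasTauDeriv ModularForm.discriminant (E2 τ * ModularForm.discriminant τ) τ := by
    have hη' : HasDerivAt ModularForm.eta (π * I / 12 * E2 τ * ModularForm.eta τ) τ := by
      refine (ModularForm.differentiableAt_eta_of_mem_upperHalfPlaneSet
          τ.im_pos).hasDerivAt.congr_deriv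
        ?_
      rw [← div_eq_iff hη]
      exact ModularForm.logDeriv_eta_eq_E2 τ
    refine .of_hasDerivAt ((hη'.pow 24).congr_deriv ?_) fun _ ↦ rfl
    rw [ModularForm.discriminant]
    simp only [Nat.cast_ofNat, Nat.reduceSub]
    ring
  have h := mul_right_cancel₀ (ModularForm.discriminant_ne_zero τ) (hd1.unique hd2)
  linear_combination -h / 12

lemma hasTauDeriv_E4 (τ : ℍ) : HasTauDeriv E4 ((E2 τ * E4 τ - E6 τ) / 3) τ := by
  refine ((((ramanujan τ).2.1.const_mul 12)).congr_fun fun τ ↦ ?_).congr_deriv ?_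
  · rw [gTwo_eq]; ring
  · rw [gTwo_eq, gThree_eq, thetaC_eq]; ring

lemma hasTauDeriv_E6 (τ : ℍ) : HasTauDeriv E6 ((E2 τ * E6 τ - E4 τ ^ 2) / 2) τ := by
  refine ((((ramanujan τ).2.2.const_mul (-216))).congr_fun fun τ ↦ ?_).congr_deriv ?_
  · rw [gThree_eq]; ring
  · rw [gTwo_eq, gThree_eq, thetaC_eq]; ring

/-! ### Derivatives of the two basic forms -/

/-- The derivative of `jacX` in the elliptic variable. -/
def jacXz (τ : ℍ) (z : ℂ) : ℂ := 2 * thetaD 0 τ z * thetaD 1 τ z / thetaD 1 τ 0 ^ 2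

/-- The second derivative of `jacX` in the elliptic variable. -/
def jacXzz (τ : ℍ) (z : ℂ) : ℂ :=
  2 * (thetaD 1 τ z ^ 2 + thetaD 0 τ z * thetaD 2 τ z) / thetaD 1 τ 0 ^ 2

/-- The derivative of `jacX` in the modular variable. -/
def jacXt (τ : ℍ) (z : ℂ) : ℂ :=
  thetaD 0 τ z * thetaD 2 τ z / thetaD 1 τ 0 ^ 2 + 3 * thetaC τ * jacX τ z

/-- The derivative of `jacY` in the elliptic variable. -/
def jacYz (τ : ℍ) (z : ℂ) : ℂ :=
  (thetaD 1 τ z * thetaD 2 τ z - thetaD 0 τ z * thetaD 3 τ z) / thetaD 1 τ 0 ^ 2 -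
    thetaC τ * jacXz τ z

/-- The second derivative of `jacY` in the elliptic variable. -/
def jacYzz (τ : ℍ) (z : ℂ) : ℂ :=
  (thetaD 2 τ z ^ 2 - thetaD 0 τ z * thetaD 4 τ z) / thetaD 1 τ 0 ^ 2 - thetaC τ * jacXzz τ z

/-- The derivative of `jacY` in the modular variable. -/
def jacYt (τ : ℍ) (z : ℂ) : ℂ :=
  (thetaD 1 τ z * thetaD 3 τ z - 1 / 2 * thetaD 2 τ z ^ 2 -
      1 / 2 * thetaD 0 τ z * thetaD 4 τ z) / thetaD 1 τ 0 ^ 2 +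
    3 * thetaC τ * (thetaP τ z / thetaD 1 τ 0 ^ 2) -
    ((gTwo τ / 12 - thetaC τ ^ 2) * jacX τ z + thetaC τ * jacXt τ z)

section Derivatives

variable (τ : ℍ) (z : ℂ)

lemma HasNDerivAt.div_const {f : ℂ → ℂ} {f' x : ℂ} (hf : HasNDerivAt f f' x) (c : ℂ) :
    HasNDerivAt (fun y ↦ f y / c) (f' / c) x :=
  (HasDerivAt.div_const hf c).congr_deriv (by ring)

lemma hasNDerivAt_jacX : HasNDerivAt (jacX τ) (jacXz τ z) z := by
  refine (((hasNDerivAt_thetaD 0 τ z).pow 2).div_const _).congr_deriv ?_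
  simp [jacXz]

lemma hasNDerivAt_jacXz : HasNDerivAt (jacXz τ) (jacXzz τ z) z := by
  refine ((((hasNDerivAt_thetaD 0 τ z).const_mul 2).mul
    (hasNDerivAt_thetaD 1 τ z)).div_const _).congr_deriv ?_
  simp only [jacXzz, zero_add, Nat.reduceAdd]
  ring

lemma hasNDerivAt_jacY : HasNDerivAt (jacY τ) (jacYz τ z) z :=
  ((hasNDerivAt_thetaP τ z).div_const _).sub ((hasNDerivAt_jacX τ z).const_mul _)

lemma hasNDerivAt_jacYz : HasNDerivAt (jacYz τ) (jacYzz τ z) z := by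
  refine (((((hasNDerivAt_thetaD 1 τ z).mul (hasNDerivAt_thetaD 2 τ z)).sub
    ((hasNDerivAt_thetaD 0 τ z).mul (hasNDerivAt_thetaD 3 τ z))).div_const _).sub
      ((hasNDerivAt_jacXz τ z).const_mul _)).congr_deriv ?_
  simp only [jacYzz, zero_add, Nat.reduceAdd]
  ring

lemma hasTauDeriv_sq_thetaD_one_zero :
    HasTauDeriv (fun τ ↦ thetaD 1 τ 0 ^ 2) (-3 * thetaC τ * thetaD 1 τ 0 ^ 2) τ := by
  refine ((hasTauDeriv_thetaD 1 τ 0).pow 2).congr_deriv ?_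
  have := thetaD_one_zero_ne_zero τ
  simp only [thetaC, Nat.cast_ofNat, Nat.reduceSub, Nat.reduceAdd]
  field_simp

lemma hasTauDeriv_div_sq {F : ℍ → ℂ} {F' : ℂ} {τ : ℍ} (hF : HasTauDeriv F F' τ) :
    HasTauDeriv (fun τ ↦ F τ / thetaD 1 τ 0 ^ 2)
      (F' / thetaD 1 τ 0 ^ 2 + 3 * thetaC τ * (F τ / thetaD 1 τ 0 ^ 2)) τ := by
  have := thetaD_one_zero_ne_zero τ
  refine (hF.div (hasTauDeriv_sq_thetaD_one_zero τ) (pow_ne_zero 2 this)).congr_deriv ?_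
  field_simp
  ring

lemma hasTauDeriv_jacX : HasTauDeriv (fun τ ↦ jacX τ z) (jacXt τ z) τ := by
  refine (hasTauDeriv_div_sq ((hasTauDeriv_thetaD 0 τ z).pow 2)).congr_deriv ?_
  simp only [jacXt, jacX, Nat.cast_ofNat, Nat.reduceSub, zero_add]
  ring

lemma hasTauDeriv_jacY : HasTauDeriv (fun τ ↦ jacY τ z) (jacYt τ z) τ := by
  have t (k : ℕ) := hasTauDeriv_thetaD k τ z
  refine ((hasTauDeriv_div_sq (((t 1).pow 2).sub ((t 0).mul (t 2)))).sub
    ((ramanujan τ).1.mul (hasTauDeriv_jacX τ z))).congr_deriv ?_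
  simp only [jacYt, thetaP, Nat.cast_ofNat, Nat.reduceSub, Nat.reduceAdd]
  ring

end Derivatives

/-! ### Bilinear relations and the heat operator on the basic forms -/

/-- The fourth Hirota derivative of `ϑ`, from `wp'' = 6 wp² - g₂/2`. -/
lemma theta_hirota (τ : ℍ) (z : ℂ) :
    2 * (thetaD 0 τ z * thetaD 4 τ z - 4 * thetaD 1 τ z * thetaD 3 τ z + 3 * thetaD 2 τ z ^ 2) =
      (gTwo τ - 12 * thetaC τ ^ 2) * thetaD 0 τ z ^ 2 + 24 * thetaC τ * thetaP τ z := by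
  have h (k : ℕ) := continuous_thetaD k τ
  have hP := (differentiable_thetaP τ).continuous
  refine eq_of_eqOn_compl_lattice (L := periodPair τ)
    (f := fun z ↦ 2 * (thetaD 0 τ z * thetaD 4 τ z - 4 * thetaD 1 τ z * thetaD 3 τ z +
      3 * thetaD 2 τ z ^ 2))
    (g := fun z ↦ (gTwo τ - 12 * thetaC τ ^ 2) * thetaD 0 τ z ^ 2 + 24 * thetaC τ * thetaP τ z)
    ?_ ?_ (fun w hw ↦ ?_) z
  · exact continuous_const.mul ((((h 0).mul (h 4)).sub
      ((continuous_const.mul (h 1)).mul (h 3))).add (continuous_const.mul ((h 2).pow 2)))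
  · exact (continuous_const.mul ((h 0).pow 2)).add (continuous_const.mul hP)
  · obtain ⟨h1, h2, h3, h4, -⟩ := thetaD_eq_mul hw
    simp only [thetaP_eq hw]
    rw [h1, h2, h3, h4]
    ring

/-- The heat operator of index `1` on `jacX`. -/
lemma heat_jacX (τ : ℍ) (z : ℂ) :
    12 * jacXt τ z - 3 * jacXzz τ z = -5 / 2 * E2 τ * jacX τ z - 6 * jacY τ z := by
  have hc := thetaC_eq τ
  rw [jacXt, jacXzz, jacY, thetaP]
  linear_combination 30 * jacX τ z * hc

/-- The heat operator of index `1` on `jacY`. -/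
lemma heat_jacY (τ : ℍ) (z : ℂ) :
    12 * jacYt τ z - 3 * jacYzz τ z = -1 / 2 * E2 τ * jacY τ z - 5 / 24 * E4 τ * jacX τ z := by
  have hc := thetaC_eq τ
  have hg := gTwo_eq τ
  have hh := theta_hirota τ z
  have hA := thetaD_one_zero_ne_zero τ
  have hX : thetaD 0 τ z ^ 2 = jacX τ z * thetaD 1 τ 0 ^ 2 := by
    rw [jacX]; field_simp
  rw [hX] at hh
  have hE2 : E2 τ = -12 * thetaC τ := by linear_combination 12 * hc
  have hE4 : E4 τ = 12 * gTwo τ := by linear_combination -12 * hg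
  rw [hE2, hE4, jacYt, jacYzz, jacXt, jacXzz, jacY]
  rw [thetaP] at *
  field_simp
  linear_combination (-72) * hh

/-- The second Hirota derivatives of `jacX` and `jacY`, expressed through `jacX` and `jacY`. -/
lemma hirota_jac (τ : ℍ) (z : ℂ) :
    jacX τ z * jacXzz τ z - jacXz τ z ^ 2 =
        -2 * jacX τ z * jacY τ z + E2 τ / 6 * jacX τ z ^ 2 ∧
    jacX τ z * jacYzz τ z + jacY τ z * jacXzz τ z - 2 * jacXz τ z * jacYz τ z =
        2 * jacY τ z ^ 2 + E2 τ / 3 * jacX τ z * jacY τ z - E4 τ / 24 * jacX τ z ^ 2 ∧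
    jacY τ z * jacYzz τ z - jacYz τ z ^ 2 =
        E2 τ / 6 * jacY τ z ^ 2 + E4 τ / 24 * jacX τ z * jacY τ z -
          E6 τ / 216 * jacX τ z ^ 2 := by
  have h (k : ℕ) := continuous_thetaD k τ
  have hX := continuous_jacX τ
  have hY := continuous_jacY τ
  have hXz : Continuous (jacXz τ) := ((continuous_const.mul (h 0)).mul (h 1)).div_const _
  have hXzz : Continuous (jacXzz τ) :=
    (continuous_const.mul (((h 1).pow 2).add ((h 0).mul (h 2)))).div_const _
  have hYz : Continuous (jacYz τ) :=
    ((((h 1).mul (h 2)).sub ((h 0).mul (h 3))).div_const _).sub (continuous_const.mul hXz)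
  have hYzz : Continuous (jacYzz τ) :=
    ((((h 2).pow 2).sub ((h 0).mul (h 4))).div_const _).sub (continuous_const.mul hXzz)
  have hE2 : E2 τ = -12 * thetaC τ := by linear_combination 12 * thetaC_eq τ
  have hE4 : E4 τ = 12 * gTwo τ := by linear_combination -12 * gTwo_eq τ
  have hE6 : E6 τ = -216 * gThree τ := by linear_combination 216 * gThree_eq τ
  have hA := thetaD_one_zero_ne_zero τ
  -- off the lattice all functions are polynomials in `wp`, `wp'` and `∂_z log ϑ` times `jacX`
  have hjet {w : ℂ} (hw : w ∉ (periodPair τ).lattice) :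
      jacXz τ w = 2 * thetaL τ w * jacX τ w ∧
      jacXzz τ w = 2 * (2 * thetaL τ w ^ 2 - wp τ w - thetaC τ) * jacX τ w ∧
      jacYz τ w = (wpDeriv τ w + 2 * thetaL τ w * wp τ w) * jacX τ w ∧
      jacYzz τ w = (6 * wp τ w ^ 2 - gTwo τ / 2 + 4 * thetaL τ w * wpDeriv τ w +
        2 * (2 * thetaL τ w ^ 2 - wp τ w - thetaC τ) * wp τ w) * jacX τ w := by
    obtain ⟨h1, h2, h3, h4, -⟩ := thetaD_eq_mul hw
    rw [jacYzz, jacYz, jacXzz, jacXz, jacX, h1, h2, h3, h4]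
    refine ⟨?_, ?_, ?_, ?_⟩ <;> ring
  refine ⟨?_, ?_, ?_⟩
  · refine eq_of_eqOn_compl_lattice (L := periodPair τ)
      (f := fun z ↦ jacX τ z * jacXzz τ z - jacXz τ z ^ 2)
      (g := fun z ↦ -2 * jacX τ z * jacY τ z + E2 τ / 6 * jacX τ z ^ 2)
      (by fun_prop) (by fun_prop) (fun w hw ↦ ?_) z
    obtain ⟨h1, h2, -, -⟩ := hjet hw
    simp only [h1, h2, jacY_eq hw, hE2]
    ring
  · refine eq_of_eqOn_compl_lattice (L := periodPair τ)
      (f := fun z ↦ jacX τ z * jacYzz τ z + jacY τ z * jacXzz τ z - 2 * jacXz τ z * jacYz τ z)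
      (g := fun z ↦ 2 * jacY τ z ^ 2 + E2 τ / 3 * jacX τ z * jacY τ z -
        E4 τ / 24 * jacX τ z ^ 2)
      (by fun_prop) (by fun_prop) (fun w hw ↦ ?_) z
    obtain ⟨h1, h2, h3, h4⟩ := hjet hw
    simp only [h1, h2, h3, h4, jacY_eq hw, hE2, hE4]
    ring
  · refine eq_of_eqOn_compl_lattice (L := periodPair τ)
      (f := fun z ↦ jacY τ z * jacYzz τ z - jacYz τ z ^ 2)
      (g := fun z ↦ E2 τ / 6 * jacY τ z ^ 2 + E4 τ / 24 * jacX τ z * jacY τ z -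
        E6 τ / 216 * jacX τ z ^ 2)
      (by fun_prop) (by fun_prop) (fun w hw ↦ ?_) z
    obtain ⟨-, -, h3, h4⟩ := hjet hw
    simp only [h3, h4, jacY_eq hw, hE2, hE4, hE6]
    linear_combination -jacX τ w ^ 2 * wpDeriv_sq hw

/-! ### The heat operator on forms in `jacX` and `jacY` -/

/-- `F`, of weight `w`, has Serre derivative `F'` at `τ`, that is,
`(2πi)⁻¹ dF/dτ = (w/12) E₂ F + F'`. -/
def HasSerreDeriv (w : ℂ) (F : ℍ → ℂ) (F' : ℂ) (τ : ℍ) : Prop :=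
  HasTauDeriv F (w / 12 * E2 τ * F τ + F') τ

namespace HasSerreDeriv

variable {w : ℂ} {F G : ℍ → ℂ} {F' G' : ℂ} {τ : ℍ}

lemma zero (w : ℂ) (τ : ℍ) : HasSerreDeriv w (fun _ ↦ 0) 0 τ :=
  (HasTauDeriv.const 0 τ).congr_deriv (by ring)

lemma add (hF : HasSerreDeriv w F F' τ) (hG : HasSerreDeriv w G G' τ) :
    HasSerreDeriv w (fun τ ↦ F τ + G τ) (F' + G') τ :=
  (HasTauDeriv.add hF hG).congr_deriv (by ring)

lemma const_mul (c : ℂ) (hF : HasSerreDeriv w F F' τ) :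
    HasSerreDeriv w (fun τ ↦ c * F τ) (c * F') τ :=
  (HasTauDeriv.const_mul c hF).congr_deriv (by ring)

/-- The Serre derivative of a monomial in `E₄` and `E₆`. The factors `a` and `b` make the
truncated exponents harmless. -/
lemma monomial (a b : ℕ) (hw : w = 4 * a + 6 * b) (τ : ℍ) :
    HasSerreDeriv w (fun τ ↦ E4 τ ^ a * E6 τ ^ b)
      (-(a / 3 * E4 τ ^ (a - 1) * E6 τ ^ (b + 1)) - b / 2 * E4 τ ^ (a + 2) * E6 τ ^ (b - 1)) τ := by
  refine (((hasTauDeriv_E4 τ).pow a).mul ((hasTauDeriv_E6 τ).pow b)).congr_deriv ?_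
  subst hw
  rcases a with _ | a <;> rcases b with _ | b <;>
    simp only [Nat.cast_zero, Nat.cast_add, Nat.cast_one, Nat.add_sub_cancel] <;> ring

end HasSerreDeriv

/-- The heat operator evaluated through normalized derivatives. -/
lemma heat_eq {m : ℚ} {φ : ℍ → ℂ → ℂ} {φz : ℂ → ℂ} {φzz φt : ℂ} {τ : ℍ} {z : ℂ}
    (h1 : ∀ z, HasNDerivAt (φ τ) (φz z) z) (h2 : HasNDerivAt φz φzz z)
    (ht : HasTauDeriv (fun τ ↦ φ τ z) φt τ) :
    heat m φ τ z = 12 * φt - 3 / m * φzz := by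
  have hpi := two_pi_I_ne_zero
  have e1 : deriv (φ τ) = fun z ↦ 2 * π * I * φz z := funext fun z ↦ HasDerivAt.deriv (h1 z)
  have e2 : iteratedDeriv 2 (φ τ) z = 2 * π * I * (2 * π * I * φzz) := by
    rw [iteratedDeriv_succ, iteratedDeriv_one, e1]
    exact HasDerivAt.deriv (HasDerivAt.const_mul (2 * π * I) h2)
  rw [heat, ht.normalizedDeriv_eq, e2]
  field_simp

/-- The operator `H_k` of index `3` on cubic forms in `jacX` and `jacY`. -/
lemma modHeat_cubic {k : ℤ} {q₀ q₁ q₂ q₃ s₀ s₁ s₂ s₃ : ℍ → ℂ} {φ : ℍ → ℂ → ℂ}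
    (h₀ : ∀ τ, HasSerreDeriv (k + 6) q₀ (s₀ τ) τ) (h₁ : ∀ τ, HasSerreDeriv (k + 4) q₁ (s₁ τ) τ)
    (h₂ : ∀ τ, HasSerreDeriv (k + 2) q₂ (s₂ τ) τ) (h₃ : ∀ τ, HasSerreDeriv k q₃ (s₃ τ) τ)
    (hφ : ∀ τ z, φ τ z = q₀ τ * jacX τ z ^ 3 + q₁ τ * (jacX τ z ^ 2 * jacY τ z) +
      q₂ τ * (jacX τ z * jacY τ z ^ 2) + q₃ τ * jacY τ z ^ 3) (τ : ℍ) (z : ℂ) :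
    modHeat 3 k φ τ z =
      (12 * s₀ τ - 7 / 24 * E4 τ * q₁ τ - 1 / 108 * E6 τ * q₂ τ) * jacX τ z ^ 3 +
      (12 * s₁ τ - 30 * q₀ τ - 5 / 12 * E4 τ * q₂ τ - 1 / 36 * E6 τ * q₃ τ) *
        (jacX τ z ^ 2 * jacY τ z) +
      (12 * s₂ τ - 12 * q₁ τ - 3 / 8 * E4 τ * q₃ τ) * (jacX τ z * jacY τ z ^ 2) +
      (12 * s₃ τ - 2 * q₂ τ) * jacY τ z ^ 3 := by
  have hX (z : ℂ) := hasNDerivAt_jacX τ z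
  have hY (z : ℂ) := hasNDerivAt_jacY τ z
  have hXz := hasNDerivAt_jacXz τ z
  have hYz := hasNDerivAt_jacYz τ z
  have hXt := hasTauDeriv_jacX τ z
  have hYt := hasTauDeriv_jacY τ z
  have hP := ((((hX z).pow 2).const_mul (3 * q₀ τ)).add
      (((hX z).mul (hY z)).const_mul (2 * q₁ τ))).add (((hY z).pow 2).const_mul (q₂ τ))
  have hR := ((((hX z).pow 2).const_mul (q₁ τ)).add (((hX z).mul (hY z)).const_mul (2 * q₂ τ))).add
      (((hY z).pow 2).const_mul (3 * q₃ τ))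
  have hz (z : ℂ) := (((((hX z).pow 3).const_mul (q₀ τ)).add
      ((((hX z).pow 2).mul (hY z)).const_mul (q₁ τ))).add
      (((hX z).mul ((hY z).pow 2)).const_mul (q₂ τ))).add (((hY z).pow 3).const_mul (q₃ τ))
  have ht := ((((h₀ τ).mul (hXt.pow 3)).add ((h₁ τ).mul ((hXt.pow 2).mul hYt))).add
      ((h₂ τ).mul (hXt.mul (hYt.pow 2)))).add ((h₃ τ).mul (hYt.pow 3))
  have hzz := (hP.mul hXz).add (hR.mul hYz)
  have h := heat_eq (φ := φ) (m := 3)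
    (φz := fun z ↦
      (3 * q₀ τ * jacX τ z ^ 2 + 2 * q₁ τ * (jacX τ z * jacY τ z) + q₂ τ * jacY τ z ^ 2) *
        jacXz τ z +
      (q₁ τ * jacX τ z ^ 2 + 2 * q₂ τ * (jacX τ z * jacY τ z) + 3 * q₃ τ * jacY τ z ^ 2) *
        jacYz τ z)
    (fun z ↦ ((hz z).congr_of_eventuallyEq (.of_forall (hφ τ))).congr_deriv (by
      simp only [Nat.cast_ofNat, Nat.reduceSub]; ring)) hzz (ht.congr_fun fun τ ↦ hφ τ z)
  obtain ⟨e1, e2, e3⟩ := hirota_jac τ z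
  have e4 := heat_jacX τ z
  have e5 := heat_jacY τ z
  rw [modHeat, h, hφ]
  simp only [Nat.cast_ofNat, Nat.reduceSub, Rat.cast_ofNat]
  -- the multipliers of `e4` and `e5` are the first partial derivatives of the form in `jacX` and
  -- `jacY`; those of `e1`, `e2` and `e3` are, up to a constant, the second partial derivatives
  linear_combination
    (3 * q₀ τ * jacX τ z ^ 2 + 2 * q₁ τ * (jacX τ z * jacY τ z) + q₂ τ * jacY τ z ^ 2) * e4 +
    (q₁ τ * jacX τ z ^ 2 + 2 * q₂ τ * (jacX τ z * jacY τ z) + 3 * q₃ τ * jacY τ z ^ 2) * e5 +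
    ((6 * q₀ τ * jacX τ z + 2 * q₁ τ * jacY τ z) * e1 +
      (2 * q₁ τ * jacX τ z + 2 * q₂ τ * jacY τ z) * e2 +
      (2 * q₂ τ * jacX τ z + 6 * q₃ τ * jacY τ z) * e3)

/-- The operator `H_k` of index `4` on quartic forms in `jacX` and `jacY`. -/
lemma modHeat_quartic {k : ℤ} {q₀ q₁ q₂ q₃ q₄ s₀ s₁ s₂ s₃ s₄ : ℍ → ℂ} {φ : ℍ → ℂ → ℂ}
    (h₀ : ∀ τ, HasSerreDeriv (k + 8) q₀ (s₀ τ) τ) (h₁ : ∀ τ, HasSerreDeriv (k + 6) q₁ (s₁ τ) τ)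
    (h₂ : ∀ τ, HasSerreDeriv (k + 4) q₂ (s₂ τ) τ) (h₃ : ∀ τ, HasSerreDeriv (k + 2) q₃ (s₃ τ) τ)
    (h₄ : ∀ τ, HasSerreDeriv k q₄ (s₄ τ) τ)
    (hφ : ∀ τ z, φ τ z = q₀ τ * jacX τ z ^ 4 + q₁ τ * (jacX τ z ^ 3 * jacY τ z) +
      q₂ τ * (jacX τ z ^ 2 * jacY τ z ^ 2) + q₃ τ * (jacX τ z * jacY τ z ^ 3) +
      q₄ τ * jacY τ z ^ 4) (τ : ℍ) (z : ℂ) :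
    modHeat 4 k φ τ z =
      (12 * s₀ τ - 29 / 96 * E4 τ * q₁ τ - 1 / 144 * E6 τ * q₂ τ) * jacX τ z ^ 4 +
      (12 * s₁ τ - 42 * q₀ τ - 23 / 48 * E4 τ * q₂ τ - 1 / 48 * E6 τ * q₃ τ) *
        (jacX τ z ^ 3 * jacY τ z) +
      (12 * s₂ τ - 45 / 2 * q₁ τ - 17 / 32 * E4 τ * q₃ τ - 1 / 24 * E6 τ * q₄ τ) *
        (jacX τ z ^ 2 * jacY τ z ^ 2) +
      (12 * s₃ τ - 9 * q₂ τ - 11 / 24 * E4 τ * q₄ τ) * (jacX τ z * jacY τ z ^ 3) +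
      (12 * s₄ τ - 3 / 2 * q₃ τ) * jacY τ z ^ 4 := by
  have hX (z : ℂ) := hasNDerivAt_jacX τ z
  have hY (z : ℂ) := hasNDerivAt_jacY τ z
  have hXz := hasNDerivAt_jacXz τ z
  have hYz := hasNDerivAt_jacYz τ z
  have hXt := hasTauDeriv_jacX τ z
  have hYt := hasTauDeriv_jacY τ z
  have hP := (((((hX z).pow 3).const_mul (4 * q₀ τ)).add
      ((((hX z).pow 2).mul (hY z)).const_mul (3 * q₁ τ))).add
      (((hX z).mul ((hY z).pow 2)).const_mul (2 * q₂ τ))).add (((hY z).pow 3).const_mul (q₃ τ))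
  have hR := (((((hX z).pow 3).const_mul (q₁ τ)).add
      ((((hX z).pow 2).mul (hY z)).const_mul (2 * q₂ τ))).add
      (((hX z).mul ((hY z).pow 2)).const_mul (3 * q₃ τ))).add (((hY z).pow 3).const_mul (4 * q₄ τ))
  have hz (z : ℂ) := ((((((hX z).pow 4).const_mul (q₀ τ)).add
      ((((hX z).pow 3).mul (hY z)).const_mul (q₁ τ))).add
      ((((hX z).pow 2).mul ((hY z).pow 2)).const_mul (q₂ τ))).add
      (((hX z).mul ((hY z).pow 3)).const_mul (q₃ τ))).add (((hY z).pow 4).const_mul (q₄ τ))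
  have ht := (((((h₀ τ).mul (hXt.pow 4)).add ((h₁ τ).mul ((hXt.pow 3).mul hYt))).add
      ((h₂ τ).mul ((hXt.pow 2).mul (hYt.pow 2)))).add ((h₃ τ).mul (hXt.mul (hYt.pow 3)))).add
      ((h₄ τ).mul (hYt.pow 4))
  have hzz := (hP.mul hXz).add (hR.mul hYz)
  have h := heat_eq (φ := φ) (m := 4)
    (φz := fun z ↦
      (4 * q₀ τ * jacX τ z ^ 3 + 3 * q₁ τ * (jacX τ z ^ 2 * jacY τ z) +
        2 * q₂ τ * (jacX τ z * jacY τ z ^ 2) + q₃ τ * jacY τ z ^ 3) * jacXz τ z +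
      (q₁ τ * jacX τ z ^ 3 + 2 * q₂ τ * (jacX τ z ^ 2 * jacY τ z) +
        3 * q₃ τ * (jacX τ z * jacY τ z ^ 2) + 4 * q₄ τ * jacY τ z ^ 3) * jacYz τ z)
    (fun z ↦ ((hz z).congr_of_eventuallyEq (.of_forall (hφ τ))).congr_deriv (by
      simp only [Nat.cast_ofNat, Nat.reduceSub]; ring)) hzz (ht.congr_fun fun τ ↦ hφ τ z)
  obtain ⟨e1, e2, e3⟩ := hirota_jac τ z
  have e4 := heat_jacX τ z
  have e5 := heat_jacY τ z
  rw [modHeat, h, hφ]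
  simp only [Nat.cast_ofNat, Nat.reduceSub, Rat.cast_ofNat]
  -- the multipliers of `e4` and `e5` are the first partial derivatives of the form in `jacX` and
  -- `jacY`; those of `e1`, `e2` and `e3` are, up to a constant, the second partial derivatives
  linear_combination
    (4 * q₀ τ * jacX τ z ^ 3 + 3 * q₁ τ * (jacX τ z ^ 2 * jacY τ z) +
        2 * q₂ τ * (jacX τ z * jacY τ z ^ 2) + q₃ τ * jacY τ z ^ 3) * e4 +
    (q₁ τ * jacX τ z ^ 3 + 2 * q₂ τ * (jacX τ z ^ 2 * jacY τ z) +
        3 * q₃ τ * (jacX τ z * jacY τ z ^ 2) + 4 * q₄ τ * jacY τ z ^ 3) * e5 +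
    3 / 4 * (
      (12 * q₀ τ * jacX τ z ^ 2 + 6 * q₁ τ * (jacX τ z * jacY τ z) + 2 * q₂ τ * jacY τ z ^ 2) * e1 +
      (3 * q₁ τ * jacX τ z ^ 2 + 4 * q₂ τ * (jacX τ z * jacY τ z) + 3 * q₃ τ * jacY τ z ^ 2) * e2 +
      (2 * q₂ τ * jacX τ z ^ 2 + 6 * q₃ τ * (jacX τ z * jacY τ z) + 12 * q₄ τ * jacY τ z ^ 2) * e3)

/-! ### The iterated heat operators on the two forms -/

lemma phiZeroThree_eq_cubic (τ : ℍ) (z : ℂ) : phiZeroThree τ z =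
    1 / 216 * E6 τ * jacX τ z ^ 3 - 1 / 12 * E4 τ * (jacX τ z ^ 2 * jacY τ z) +
    4 * jacY τ z ^ 3 := by
  rw [phiZeroThree_eq, gTwo_eq, gThree_eq]
  ring

lemma modHeat_phiZeroThree_one (τ : ℍ) (z : ℂ) :
    modHeat 3 0 phiZeroThree τ z =
      -1 / 288 * E4 τ ^ 2 * jacX τ z ^ 3 + 1 / 12 * E6 τ * (jacX τ z ^ 2 * jacY τ z) -
      1 / 2 * E4 τ * (jacX τ z * jacY τ z ^ 2) := by
  refine (modHeat_cubic (k := 0)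
    (fun τ ↦ .const_mul (1 / 216) (.monomial 0 1 (by norm_num) τ))
    (fun τ ↦ .const_mul (-1 / 12) (.monomial 1 0 (by norm_num) τ))
    (fun τ ↦ .zero _ τ)
    (fun τ ↦ .const_mul 4 (.monomial 0 0 (by norm_num) τ))
    (fun τ z ↦ by rw [phiZeroThree_eq_cubic]; ring) τ z).trans ?_
  norm_num
  ring

lemma modHeat_phiZeroThree_two (τ : ℍ) (z : ℂ) :
    modHeat 3 2 (modHeat 3 0 phiZeroThree) τ z =
      7 / 864 * E4 τ * E6 τ * jacX τ z ^ 3 - 3 / 16 * E4 τ ^ 2 * (jacX τ z ^ 2 * jacY τ z) +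
      E6 τ * (jacX τ z * jacY τ z ^ 2) + E4 τ * jacY τ z ^ 3 := by
  refine (modHeat_cubic (k := 2)
    (fun τ ↦ .const_mul (-1 / 288) (.monomial 2 0 (by norm_num) τ))
    (fun τ ↦ .const_mul (1 / 12) (.monomial 0 1 (by norm_num) τ))
    (fun τ ↦ .const_mul (-1 / 2) (.monomial 1 0 (by norm_num) τ))
    (fun τ ↦ .zero _ τ)
    (fun τ z ↦ by rw [modHeat_phiZeroThree_one]; ring) τ z).trans ?_
  norm_num
  ring

lemma modHeat_phiZeroThree_three (τ : ℍ) (z : ℂ) :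
    modHeat 3 4 (modHeat 3 2 (modHeat 3 0 phiZeroThree)) τ z =
      (7 / 1152 * E4 τ ^ 3 - 1 / 24 * E6 τ ^ 2) * jacX τ z ^ 3 +
      13 / 16 * E4 τ * E6 τ * (jacX τ z ^ 2 * jacY τ z) -
      33 / 8 * E4 τ ^ 2 * (jacX τ z * jacY τ z ^ 2) - 6 * E6 τ * jacY τ z ^ 3 := by
  refine (modHeat_cubic (k := 4)
    (fun τ ↦ .const_mul (7 / 864) (.monomial 1 1 (by norm_num) τ))
    (fun τ ↦ .const_mul (-3 / 16) (.monomial 2 0 (by norm_num) τ))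
    (fun τ ↦ .const_mul 1 (.monomial 0 1 (by norm_num) τ))
    (fun τ ↦ .const_mul 1 (.monomial 1 0 (by norm_num) τ))
    (fun τ z ↦ by rw [modHeat_phiZeroThree_two]; ring) τ z).trans ?_
  norm_num
  ring

lemma modHeat_phiZeroThree_four (τ : ℍ) (z : ℂ) :
    modHeat 3 6 (modHeat 3 4 (modHeat 3 2 (modHeat 3 0 phiZeroThree))) τ z =
      263 / 1152 * E4 τ ^ 2 * E6 τ * jacX τ z ^ 3 +
      (-641 / 192 * E4 τ ^ 3 - 11 / 6 * E6 τ ^ 2) * (jacX τ z ^ 2 * jacY τ z) +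
      51 / 2 * E4 τ * E6 τ * (jacX τ z * jacY τ z ^ 2) + 177 / 4 * E4 τ ^ 2 * jacY τ z ^ 3 := by
  refine (modHeat_cubic (k := 6)
    (fun τ ↦ .add (.const_mul (7 / 1152) (.monomial 3 0 (by norm_num) τ))
        (.const_mul (-1 / 24) (.monomial 0 2 (by norm_num) τ)))
    (fun τ ↦ .const_mul (13 / 16) (.monomial 1 1 (by norm_num) τ))
    (fun τ ↦ .const_mul (-33 / 8) (.monomial 2 0 (by norm_num) τ))
    (fun τ ↦ .const_mul (-6) (.monomial 0 1 (by norm_num) τ))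
    (fun τ z ↦ by rw [modHeat_phiZeroThree_three]; ring) τ z).trans ?_
  norm_num
  ring

lemma phiZeroFour_eq_quartic (τ : ℍ) (z : ℂ) : phiZeroFour τ z =
      -1 / 2304 * E4 τ ^ 2 * jacX τ z ^ 4 + 1 / 72 * E6 τ * (jacX τ z ^ 3 * jacY τ z) -
      1 / 8 * E4 τ * (jacX τ z ^ 2 * jacY τ z ^ 2) + 3 * jacY τ z ^ 4 := by
  rw [phiZeroFour_eq, gTwo_eq, gThree_eq]
  ring

lemma modHeat_phiZeroFour_one (τ : ℍ) (z : ℂ) :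
    modHeat 4 0 phiZeroFour τ z =
      1 / 6912 * E4 τ * E6 τ * jacX τ z ^ 4 - 1 / 192 * E4 τ ^ 2 * (jacX τ z ^ 3 * jacY τ z) +
      1 / 16 * E6 τ * (jacX τ z ^ 2 * jacY τ z ^ 2) - 1 / 4 * E4 τ * (jacX τ z * jacY τ z ^ 3) := by
  refine (modHeat_quartic (k := 0)
    (fun τ ↦ .const_mul (-1 / 2304) (.monomial 2 0 (by norm_num) τ))
    (fun τ ↦ .const_mul (1 / 72) (.monomial 0 1 (by norm_num) τ))
    (fun τ ↦ .const_mul (-1 / 8) (.monomial 1 0 (by norm_num) τ))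
    (fun τ ↦ .zero _ τ)
    (fun τ ↦ .const_mul 3 (.monomial 0 0 (by norm_num) τ))
    (fun τ z ↦ by rw [phiZeroFour_eq_quartic]; ring) τ z).trans ?_
  norm_num
  ring

lemma modHeat_phiZeroFour_two (τ : ℍ) (z : ℂ) :
    modHeat 4 2 (modHeat 4 0 phiZeroFour) τ z =
      (13 / 18432 * E4 τ ^ 3 - 7 / 6912 * E6 τ ^ 2) * jacX τ z ^ 4 +
      25 / 2304 * E4 τ * E6 τ * (jacX τ z ^ 3 * jacY τ z) -
      1 / 8 * E4 τ ^ 2 * (jacX τ z ^ 2 * jacY τ z ^ 2) +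
      7 / 16 * E6 τ * (jacX τ z * jacY τ z ^ 3) + 3 / 8 * E4 τ * jacY τ z ^ 4 := by
  refine (modHeat_quartic (k := 2)
    (fun τ ↦ .const_mul (1 / 6912) (.monomial 1 1 (by norm_num) τ))
    (fun τ ↦ .const_mul (-1 / 192) (.monomial 2 0 (by norm_num) τ))
    (fun τ ↦ .const_mul (1 / 16) (.monomial 0 1 (by norm_num) τ))
    (fun τ ↦ .const_mul (-1 / 4) (.monomial 1 0 (by norm_num) τ))
    (fun τ ↦ .zero _ τ)
    (fun τ z ↦ by rw [modHeat_phiZeroFour_one]; ring) τ z).trans ?_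
  norm_num
  ring

lemma modHeat_phiZeroFour_three (τ : ℍ) (z : ℂ) :
    modHeat 4 4 (modHeat 4 2 (modHeat 4 0 phiZeroFour)) τ z =
      283 / 221184 * E4 τ ^ 2 * E6 τ * jacX τ z ^ 4 +
      (-107 / 3072 * E4 τ ^ 3 - 23 / 2304 * E6 τ ^ 2) * (jacX τ z ^ 3 * jacY τ z) +
      65 / 128 * E4 τ * E6 τ * (jacX τ z ^ 2 * jacY τ z ^ 2) -
      107 / 64 * E4 τ ^ 2 * (jacX τ z * jacY τ z ^ 3) - 69 / 32 * E6 τ * jacY τ z ^ 4 := by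
  refine (modHeat_quartic (k := 4)
    (fun τ ↦ .add (.const_mul (13 / 18432) (.monomial 3 0 (by norm_num) τ))
        (.const_mul (-7 / 6912) (.monomial 0 2 (by norm_num) τ)))
    (fun τ ↦ .const_mul (25 / 2304) (.monomial 1 1 (by norm_num) τ))
    (fun τ ↦ .const_mul (-1 / 8) (.monomial 2 0 (by norm_num) τ))
    (fun τ ↦ .const_mul (7 / 16) (.monomial 0 1 (by norm_num) τ))
    (fun τ ↦ .const_mul (3 / 8) (.monomial 1 0 (by norm_num) τ))
    (fun τ z ↦ by rw [modHeat_phiZeroFour_two]; ring) τ z).trans ?_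
  norm_num
  ring

/-! ### The absence of an equation of order three -/

lemma cubic_form_coeff_eq_zero {τ : ℍ} {a b c d : ℂ} (h : ∀ z, a * jacX τ z ^ 3 +
    b * (jacX τ z ^ 2 * jacY τ z) + c * (jacX τ z * jacY τ z ^ 2) + d * jacY τ z ^ 3 = 0) :
    a = 0 ∧ b = 0 ∧ c = 0 ∧ d = 0 := by
  refine cubic_coeff_eq_zero (τ := τ) fun z hz ↦ ?_
  have hX : jacX τ z ≠ 0 :=
    div_ne_zero (pow_ne_zero 2 (thetaD_zero_ne_zero hz)) (pow_ne_zero 2 (thetaD_one_zero_ne_zero τ))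
  have := h z
  rw [jacY_eq hz] at this
  apply mul_right_cancel₀ (pow_ne_zero 3 hX)
  linear_combination this

lemma E4_cube_sub_E6_sq_ne_zero (τ : ℍ) : E4 τ ^ 3 - E6 τ ^ 2 ≠ 0 := by
  have h := ModularForm.discriminant_ne_zero τ
  rw [ModularForm.discriminant_eq_E₄_cube_sub_E₆_sq] at h
  intro h0
  apply h
  rw [E4, E6] at h0
  rw [h0]
  simp

/-- The coefficient vectors of `φ_{0,3}` and its first three images under the heat operators have
determinant `(5/432) (E₄³ - E₆²)²`, a nonzero multiple of `Δ²`. -/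
lemma not_hasModularDiffEq_phiZeroThree : ¬ HasModularDiffEq 3 0 3 phiZeroThree := by
  rintro ⟨w, f, hf, h⟩
  refine hf (DFunLike.ext _ _ fun τ ↦ ?_)
  have key := cubic_form_coeff_eq_zero (τ := τ)
    (a := f 0 τ * (1 / 216 * E6 τ) + f 1 τ * (-1 / 288 * E4 τ ^ 2) +
      f 2 τ * (7 / 864 * E4 τ * E6 τ) + f 3 τ * (7 / 1152 * E4 τ ^ 3 - 1 / 24 * E6 τ ^ 2))
    (b := f 0 τ * (-1 / 12 * E4 τ) + f 1 τ * (1 / 12 * E6 τ) + f 2 τ * (-3 / 16 * E4 τ ^ 2) +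
      f 3 τ * (13 / 16 * E4 τ * E6 τ))
    (c := f 1 τ * (-1 / 2 * E4 τ) + f 2 τ * E6 τ + f 3 τ * (-33 / 8 * E4 τ ^ 2))
    (d := f 0 τ * 4 + f 2 τ * E4 τ + f 3 τ * (-6 * E6 τ)) fun z ↦ by
      have := h τ z
      simp only [Finset.sum_range_succ, Finset.sum_range_zero, modHeatIter, Nat.cast_zero,
        Nat.cast_one, Nat.cast_ofNat, Int.reduceMul, Int.reduceAdd,
        phiZeroThree_eq_cubic, modHeat_phiZeroThree_one, modHeat_phiZeroThree_two,
        modHeat_phiZeroThree_three] at this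
      linear_combination this
  obtain ⟨k0, -, k2, k3⟩ := key
  have hdet : f 3 τ * (5 / 432 * (E4 τ ^ 3 - E6 τ ^ 2) ^ 2) = 0 := by
    generalize E4 τ = a at *
    generalize E6 τ = b at *
    -- the multipliers are the cofactors of the coefficients of `f₃`; that of the
    -- coefficient at `jacX² jacY` vanishes
    linear_combination (1 / 3 * a ^ 3 - 1 / 3 * b ^ 2) * k0 +
      (-1 / 432 * a ^ 4 + 1 / 432 * a * b ^ 2) * k2 +
      (-1 / 2592 * a ^ 3 * b + 1 / 2592 * b ^ 3) * k3
  simpa [E4_cube_sub_E6_sq_ne_zero τ] using hdet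

end JacobiMDE

end

theorem mainTheorem4 :
    (∀ (τ : UpperHalfPlane) (z : ℂ),
      JacobiMDE.modHeat 3 6 (JacobiMDE.modHeat 3 4 (JacobiMDE.modHeat 3 2
          (JacobiMDE.modHeat 3 0 JacobiMDE.phiZeroThree))) τ z
        - 29 / 2 * JacobiMDE.E4 τ *
            JacobiMDE.modHeat 3 2 (JacobiMDE.modHeat 3 0 JacobiMDE.phiZeroThree) τ z
        + 22 * JacobiMDE.E6 τ * JacobiMDE.modHeat 3 0 JacobiMDE.phiZeroThree τ z
        - 119 / 16 * JacobiMDE.E8 τ * JacobiMDE.phiZeroThree τ z = 0) ∧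
    ¬ JacobiMDE.HasModularDiffEq 3 0 3 JacobiMDE.phiZeroThree ∧
    (∀ (τ : UpperHalfPlane) (z : ℂ),
      JacobiMDE.modHeat 4 4 (JacobiMDE.modHeat 4 2
          (JacobiMDE.modHeat 4 0 JacobiMDE.phiZeroFour)) τ z
        - 107 / 16 * JacobiMDE.E4 τ * JacobiMDE.modHeat 4 0 JacobiMDE.phiZeroFour τ z
        + 23 / 32 * JacobiMDE.E6 τ * JacobiMDE.phiZeroFour τ z = 0) := by
  refine ⟨fun τ z ↦ ?_, JacobiMDE.not_hasModularDiffEq_phiZeroThree, fun τ z ↦ ?_⟩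
  · rw [JacobiMDE.modHeat_phiZeroThree_four, JacobiMDE.modHeat_phiZeroThree_two,
      JacobiMDE.modHeat_phiZeroThree_one, JacobiMDE.phiZeroThree_eq_cubic, JacobiMDE.E8_eq]
    ring
  · rw [JacobiMDE.modHeat_phiZeroFour_three, JacobiMDE.modHeat_phiZeroFour_one,
      JacobiMDE.phiZeroFour_eq_quartic]
    ring
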